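/- **Setting.** Let $KS_0$ be the equilateral triangle with base $[0,1]$, lying above its base, in $\mathbb{C}=\mathbb{R}^2$, and let $KS_{n+1}$ be obtained from the polygon $KS_n$ by replacing the open middle third of each side by the two other sides of the outward equilateral triangle (a *cell* of level $n+1$) erected on it. Let $KS$ be the Koch snowflake curve, the closure of the set of all vertices of all the $KS_n$. Each side of $KS_n$ has an address: a side of $KS_0$ followed by a word of length $n$ in a four-letter alphabet, obtained by appending one letter to the address of the side of $KS_{n-1}$ it comes from. Let $f_n$ be the billiard map of the table $\Omega(KS_n)$ bounded by $KS_n$, acting on pairs (boundary point, inward unit direction), and let $\mathscr{O}_n(x,\theta)$ be the $f_n$-orbit of $(x,\theta)$. A *compatible sequence of piecewise Fagnano orbits* is a sequence of orbits $\mathscr{O}_n(x_n^0,\theta)$, $n\ge 0$, with a common direction $\theta$, where $x_n^0\in KS_n$ is not a vertex, $\theta$ is inward pointing at $x_n^0$, $x_n^0$ is collinear with $x_0^0$ in the direction $\theta$ with no point of $KS_n$ strictly between them, every orbit is closed and never meets a vertex, and there is $N$ such that for every $n\ge N$ the point $x_n^0$ is the midpoint of a side of a cell of level $n$. Let $N$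 be the least such index; then $N\geq 1$. For $N\le m\le n$ the transition map $F_{m,n}:\mathscr{O}_n(x_n^0,\theta)\to\mathscr{O}_m(x_m^0,\theta)$ is defined as follows. Let $p=f_n^{k_n}(x_n^0,\theta)$ with $1\le k_n\le \#\mathscr{O}_n(x_n^0,\theta)$, and for $n\ge i>m$ put $k_{i-1}=\zeta_i+1$, where $k_i=2\zeta_i+\beta_i$ with $\beta_i\in\{1,2\}$. Then $$F_{m,n}(p)=f_m^{k_m}\circ(\tau_{m,n}\times \mathrm{id})\circ f_n^{-k_n}(p)=f_m^{k_m}\bigl(\tau_{m,n}(x_n^0),\theta\bigr),$$ where $\tau_{m,n}$ sends the midpoint of a side of $KS_n$ to the midpoint of the side of $KS_m$ whose address is obtained by deleting the last $n-m$ letters. The *footprint* is the inverse limit $$\mathcal{F}(x_0^0)=\Bigl\{(p_i)_{i\ge N}\in\prod_{i\ge N}\mathscr{O}_i(x_i^0,\theta)\;:\;F_{m,n}(p_n)=p_m\text{ for all }N\le m\le n\Bigr\},$$ with the topology induced by the product of the discrete topologies on the finite sets $\mathscr{O}_i(x_i^0,\theta)$. **Theorem.** For every compatible sequence of piecewise Fagnano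 orbits, $\mathcal{F}(x_0^0)$ is a topological Cantor set, i.e. nonempty, compact, totally disconnected and perfect. Moreover it is a self-similar Cantor set: for every $(p_i)_{i\ge N}\in\mathcal{F}(x_0^0)$ the base points of the $p_i$ converge in the plane; sending $(p_i)$ to this limit is a topological embedding of $\mathcal{F}(x_0^0)$ into the plane, with image contained in $KS$; and the image is the union of $\Xi=\#\mathscr{O}_{N-1}(x_{N-1}^0,\theta)$ pairwise disjoint, pairwise congruent sets, each of which is the attractor of an iterated function system consisting of two contracting similarities of the plane. -/

import Mathlib

noncomputable section

namespace KochBilliard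

/-! ### The prefractal Koch snowflakes

The plane is `ℂ`. The initial equilateral triangle has the unit interval `[0,1]` as its base. Sides
are directed segments `(a, b)`, oriented counterclockwise: the billiard table lies to the left of
each side. -/

/-- The unit vector in the direction `π/3`; also the top vertex of the initial triangle. -/
def zeta : ℂ := ⟨1 / 2, Real.sqrt 3 / 2⟩

/-- The three sides of the initial triangle. -/
def rootSide : Fin 3 → ℂ × ℂ := ![(0, 1), (1, zeta), (zeta, 0)]

/-- The open middle third of a side is replaced by the two other sides of the outward equilateral
triangle erected on it. Children `0` and `3` are the outer thirds; children `1` and `2` are the two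
new sides, which are the sides of the new cell. -/
def child (s : ℂ × ℂ) : Fin 4 → ℂ × ℂ :=
  let p := s.1 + (s.2 - s.1) / 3
  let q := s.1 + 2 * (s.2 - s.1) / 3
  let c := p + (q - p) * (starRingEnd ℂ) zeta
  ![(s.1, p), (p, c), (c, q), (q, s.2)]

/-- The side with a given address: a side of the triangle and a word in `Fin 4`. The *last*
character of the address is the head of the list, so that deleting the last `j` characters of an
address is `List.drop j`. Words of length `n` address the `3 * 4 ^ n` sides of the `n`th
prefractal. -/
def side (r : Fin 3) : List (Fin 4) → ℂ × ℂ
  | [] => rootSide r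
  | d :: w => child (side r w) d

/-- The midpoint of the side with a given address. -/
def sideMid (r : Fin 3) (w : List (Fin 4)) : ℂ := midpoint ℝ (side r w).1 (side r w).2

/-- The polygonal curve `KS_n`. -/
def KS (n : ℕ) : Set ℂ :=
  {z | ∃ (r : Fin 3) (w : List (Fin 4)), w.length = n ∧ z ∈ segment ℝ (side r w).1 (side r w).2}

/-- `z` is a vertex of `KS_n` (each vertex is the initial point of a side). -/
def IsVertex (n : ℕ) (z : ℂ) : Prop :=
  ∃ (r : Fin 3) (w : List (Fin 4)), w.length = n ∧ z = (side r w).1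

/-- The Koch snowflake curve `KS`: the closure of the set of all vertices of all prefractals. -/
def snowflake : Set ℂ := closure {z | ∃ n, IsVertex n z}

/-- `z` is the midpoint of a side of `KS_n` that is a side of a cell of the `n`th table, i.e. of one
of the triangles glued at stage `n`. -/
def IsCellSideMidpoint (n : ℕ) (z : ℂ) : Prop :=
  ∃ (r : Fin 3) (w : List (Fin 4)) (d : Fin 4),
    w.length + 1 = n ∧ (d = 1 ∨ d = 2) ∧ z = sideMid r (d :: w)

/-! ### The billiard map

A point of the phase space of the `n`th table is represented by a pair `(x, θ)`, where `x` is a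
boundary point and `θ` an inward pointing unit vector. -/

/-- `x` is a point of `KS_n` which is not a vertex, and the direction `θ` points from `x` into the
interior of the table (to the left of the side containing `x`). -/
def IsInward (n : ℕ) (x θ : ℂ) : Prop :=
  ∃ (r : Fin 3) (w : List (Fin 4)), w.length = n ∧
    x ∈ openSegment ℝ (side r w).1 (side r w).2 ∧
    0 < ((starRingEnd ℂ) ((side r w).2 - (side r w).1) * θ).im

/-- The time of the first collision with `KS_n` after leaving `x` with unit velocity `θ`. -/
def hitTime (n : ℕ) (x θ : ℂ) : ℝ := sInf {t : ℝ | 0 < t ∧ x + t * θ ∈ KS n}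

open Classical in
/-- The vector spanning the side of `KS_n` on which the (non-vertex) point `y` lies. -/
def tangent (n : ℕ) (y : ℂ) : ℂ :=
  if h : ∃ s : ℂ × ℂ, (∃ (r : Fin 3) (w : List (Fin 4)), w.length = n ∧ s = side r w) ∧
      y ∈ openSegment ℝ s.1 s.2
  then h.choose.2 - h.choose.1 else 0

/-- Reflection of the vector `v` in the line spanned by `u`. -/
def reflect (u v : ℂ) : ℂ := u / (starRingEnd ℂ) u * (starRingEnd ℂ) v

/-- The billiard map `f_n` of the `n`th table: move to the first point of collision and reflect the
velocity in the side that was hit. (It is only used for orbits that never meet a vertex.) -/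
def billiardMap (n : ℕ) (p : ℂ × ℂ) : ℂ × ℂ :=
  let y := p.1 + hitTime n p.1 p.2 * p.2
  (y, reflect (tangent n y) p.2)

/-- The orbit (Poincaré section) of the initial condition `q` in the `n`th table. -/
def orbit (n : ℕ) (q : ℂ × ℂ) : Set (ℂ × ℂ) := {p | ∃ k : ℕ, p = (billiardMap n)^[k] q}

/-- The orbit of `q` is periodic: closed, and never at a vertex. -/
def IsPeriodicOrbit (n : ℕ) (q : ℂ × ℂ) : Prop :=
  (∃ k : ℕ, 0 < k ∧ (billiardMap n)^[k] q = q) ∧ ∀ k : ℕ, ¬ IsVertex n ((billiardMap n)^[k] q).1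

/-! ### Compatible sequences -/

/-- `(x n, θ)`, `n ≥ 0`, is a compatible sequence of initial conditions: `θ` is a unit vector, inward
pointing at each `x n ∈ KS_n`; `x n` is collinear with `x 0` in the direction `θ`; and no point of
`KS_n` lies strictly between `x 0` and `x n`. -/
structure IsCompatibleSeq (x : ℕ → ℂ) (θ : ℂ) : Prop where
  norm_eq_one : ‖θ‖ = 1
  inward : ∀ n, IsInward n (x n) θ
  collinear : ∀ n, ∃ t : ℝ, x n = x 0 + t * θ
  visible : ∀ n y, Sbtw ℝ (x 0) y (x n) → y ∉ KS n

/-- The orbits of `(x n, θ)` form a compatible sequence of piecewise Fagnano orbits: a compatible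
sequence of periodic orbits such that, from some level on, `x n` is the midpoint of a side of a
cell. -/
structure IsPiecewiseFagnanoSeq (x : ℕ → ℂ) (θ : ℂ) : Prop where
  compatible : IsCompatibleSeq x θ
  periodic : ∀ n, IsPeriodicOrbit n (x n, θ)
  fagnano : ∃ N, ∀ n, N ≤ n → IsCellSideMidpoint n (x n)

/-- The least level from which on the orbits are piecewise Fagnano. (For a compatible sequence of
piecewise Fagnano orbits it is at least `1`, as there are no cells at level `0`.) -/
def startLevel (x : ℕ → ℂ) : ℕ := sInf {N | ∀ n, N ≤ n → IsCellSideMidpoint n (x n)}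

/-! ### The footprint as an inverse limit -/

open Classical in
/-- Truncation of addresses from level `n` to level `m`, on midpoints of sides: the midpoint of a side
of `KS_n` goes to the midpoint of the side of `KS_m` whose address is obtained by deleting the last
`n - m` characters. -/
def truncate (m n : ℕ) (z : ℂ) : ℂ :=
  if h : ∃ a : Fin 3 × List (Fin 4), a.2.length = n ∧ z = sideMid a.1 a.2
  then sideMid h.choose.1 (h.choose.2.drop (n - m)) else z

/-- The index `k_n ∈ {1, …, period}` with `p = f_n^{k_n} q`, for `p` in the orbit of `q`. -/
def orbitIndex (n : ℕ) (q p : ℂ × ℂ) : ℕ := sInf {k | 1 ≤ k ∧ (billiardMap n)^[k] q = p}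

/-- If `k = 2ζ + β` with `β ∈ {1, 2}`, this is `ζ + 1`. -/
def pairIndex (k : ℕ) : ℕ := (k - 1) / 2 + 1

/-- The transition map `F_{m,n}` from the orbit of `q` in the `n`th table to the `m`th table,
`m ≤ n`: apply `f_n^{-k_n}`, which gives back the initial condition `q`; truncate the base point and
keep the direction; then apply `f_m^{k_m}`, where `k_{i-1} = ζ_i + 1` if `k_i = 2ζ_i + β_i`,
`β_i ∈ {1, 2}`. -/
def transition (m n : ℕ) (q p : ℂ × ℂ) : ℂ × ℂ :=
  (billiardMap m)^[pairIndex^[n - m] (orbitIndex n q p)] (truncate m n q.1, q.2)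

/-- The footprint: the inverse limit of the (finite) orbits of levels `N, N+1, …`, where `N` is the
start level, under the transition maps. The `i`th coordinate is the one at level `N + i`. As the
orbits are finite, hence discrete, subsets of `ℂ × ℂ`, the topology of the inverse limit is the
one induced from the product topology on `ℕ → ℂ × ℂ`. -/
def footprint (x : ℕ → ℂ) (θ : ℂ) : Set (ℕ → ℂ × ℂ) :=
  {p | (∀ i, p i ∈ orbit (startLevel x + i) (x (startLevel x + i), θ)) ∧
    ∀ i j, i ≤ j →
      transition (startLevel x + i) (startLevel x + j) (x (startLevel x + j), θ) (p j) = p i}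

/-! ### Cantor sets and self-similar sets -/

/-- A topological Cantor set: nonempty, compact, totally disconnected and perfect. -/
def IsTopologicalCantorSet {X : Type*} [TopologicalSpace X] (S : Set X) : Prop :=
  S.Nonempty ∧ IsCompact S ∧ IsTotallyDisconnected S ∧ Perfect S

/-- A contracting similarity of the plane. -/
def IsContractingSimilarity (φ : ℂ → ℂ) : Prop :=
  ∃ ρ : ℝ, 0 < ρ ∧ ρ < 1 ∧ ∀ z w, dist (φ z) (φ w) = ρ * dist z w

/-- `A` is the attractor of the iterated function system `φ 0, φ 1`: the nonempty compact set with
`A = φ 0 (A) ∪ φ 1 (A)`. -/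
def IsAttractor (φ : Fin 2 → ℂ → ℂ) (A : Set ℂ) : Prop :=
  A.Nonempty ∧ IsCompact A ∧ ⋃ j, φ j '' A = A

/-- `S` is the union of `m` pairwise disjoint and pairwise congruent sets, each of which is the
attractor of an iterated function system of two contracting similarities. -/
def IsSelfSimilarUnion (m : ℕ) (S : Set ℂ) : Prop :=
  ∃ (φ : Fin m → Fin 2 → ℂ → ℂ) (A : Fin m → Set ℂ),
    (∀ i j, IsContractingSimilarity (φ i j)) ∧
    (∀ i, IsAttractor (φ i) (A i)) ∧
    (∀ i i', ∃ g : ℂ ≃ᵢ ℂ, g '' A i = A i') ∧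
    (∀ i i', i ≠ i' → Disjoint (A i) (A i')) ∧
    S = ⋃ i, A i

end KochBilliard

end

noncomputable section

namespace KochBilliard

open Filter Topology Set

/-! ### Affine charts of the sides -/

/-! Scaled by 3^n, the sides of `KS n` are unit steps of the Eisenstein lattice. Hence a line
leaving the midpoint of a side at angle π/3 or 2π/3 crosses every side of that level it meets at the
midpoint, and never parallel to it (`hit_midpoint`). Reflection in a lattice side preserves the cube
σ = ±1 of the velocity (`reflect_eq`), and the two inward lattice directions at a side have opposite
cubes. So the side determines the velocity, and the billiard becomes a map `next` on addresses.

Passing to the next level prolongs each flight by the same length at both ends: it now starts at one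
side of the cell over its departure side and ends at one side of the cell over its arrival side
(`Flight.lift`). In between, the trajectory crosses that cell parallel to its base (`flight_cell`).
Thus two collisions at level n+1 lie over one collision at level n, both sides of every cell over a
visited side are visited (`mem_visited_succ`), and the index rule k ↦ ζ+1 amounts to deleting the
last letter (`transition_point`).

The hypotheses put the orbits in this setting. Followed backwards, the trajectory from `x n` stays
in one cell until it reaches `x (n + 1)`, so consecutive initial sides are nested and the direction
is a lattice direction; this already holds at level M = N-1 (`exists_addresses`). The footprint is
therefore coded by a side visited at level M together with a sequence in two letters
(`mem_inverseLimit_iff`).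

Over each such side the base points converge to the attractor of the two similarities belonging to
letters 1 and 2. All separation comes from hulls, the triangles with base angles π/6 over the sides:
children's hulls lie in the parent's, and hulls of distinct sides of one level are disjoint
(`address_eq_of_hull`). This makes the limit map injective, and compactness makes it an embedding.
-/

/-- The imaginary part in units of `√3`; it makes the geometry of the triangular lattice rational. -/
def height (z : ℂ) : ℝ := z.im / Real.sqrt 3

lemma sqrt_three_pos : 0 < Real.sqrt 3 := Real.sqrt_pos.2 (by norm_num)

lemma sqrt_three_mul_self : Real.sqrt 3 * Real.sqrt 3 = 3 := Real.mul_self_sqrt (by norm_num)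

lemma im_eq_height (z : ℂ) : z.im = Real.sqrt 3 * height z := by
  unfold height
  field_simp [sqrt_three_pos.ne']

lemma ext_height {z y : ℂ} (h₁ : z.re = y.re) (h₂ : height z = height y) : z = y :=
  Complex.ext h₁ (by rw [im_eq_height, im_eq_height, h₂])

@[fun_prop]
lemma continuous_height : Continuous height := by
  unfold height
  fun_prop

@[simp] lemma height_add (z y : ℂ) : height (z + y) = height z + height y := by
  simp [height, add_div]

@[simp] lemma height_sub (z y : ℂ) : height (z - y) = height z - height y := by
  simp [height, sub_div]

@[simp] lemma height_neg (z : ℂ) : height (-z) = -height z := by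
  simp [height, neg_div]

@[simp] lemma height_ofReal (t : ℝ) : height t = 0 := by simp [height]

@[simp] lemma height_one : height 1 = 0 := by simp [height]

@[simp] lemma height_zero : height 0 = 0 := by simp [height]

lemma re_mul (z y : ℂ) : (z * y).re = z.re * y.re - 3 * (height z * height y) := by
  rw [Complex.mul_re, im_eq_height z, im_eq_height y]
  linear_combination (-height z * height y) * sqrt_three_mul_self

lemma height_mul (z y : ℂ) : height (z * y) = z.re * height y + height z * y.re := by
  simp only [height, Complex.mul_im]
  ring

@[simp] lemma height_ofReal_mul (t : ℝ) (z : ℂ) : height (t * z) = t * height z := by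
  simp [height_mul]

@[simp] lemma zeta_re : zeta.re = 1 / 2 := rfl

@[simp] lemma zeta_height : height zeta = 1 / 2 := by
  have := sqrt_three_pos.ne'
  simp only [height, zeta]
  field_simp

@[simp] lemma height_conj (z : ℂ) : height ((starRingEnd ℂ) z) = -height z := by
  simp [height, neg_div]

lemma conj_zeta : (starRingEnd ℂ) zeta = 1 - zeta :=
  ext_height (by simp; norm_num) (by simp)

lemma zeta_sq : zeta ^ 2 = zeta - 1 := by
  rw [sq]
  exact ext_height (by simp only [re_mul, Complex.sub_re, zeta_re, zeta_height]; norm_num)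
    (by simp only [height_mul, height_sub, zeta_re, zeta_height, height_one]; norm_num)

lemma zeta_pow_three : zeta ^ 3 = -1 := by
  linear_combination (zeta + 1) * zeta_sq

/-- The affine map taking `0` and `1` to the end points of a segment. -/
def segChart (s : ℂ × ℂ) (z : ℂ) : ℂ := s.1 + (s.2 - s.1) * z

/-- The chart of a side. -/
def chart (r : Fin 3) (w : List (Fin 4)) : ℂ → ℂ := segChart (side r w)

/-- The chart of a child of the unit interval. -/
def childChart (d : Fin 4) : ℂ → ℂ := segChart (child (0, 1) d)

lemma segChart_child (s : ℂ × ℂ) (d : Fin 4) (z : ℂ) :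
    segChart (child s d) z = segChart s (childChart d z) := by
  fin_cases d <;> simp [segChart, childChart, child] <;> ring

/-- Subdivision commutes with similarities, so a further letter precomposes the chart with a fixed
map of the unit interval. Inductions on addresses thereby reduce to the unit interval. -/
lemma chart_cons (r : Fin 3) (d : Fin 4) (w : List (Fin 4)) (z : ℂ) :
    chart r (d :: w) z = chart r w (childChart d z) := segChart_child _ _ _

lemma childChart_zero (z : ℂ) : childChart 0 z = (1 / 3 : ℝ) * z := by
  simp [segChart, childChart, child]

lemma childChart_one (z : ℂ) :
    childChart 1 z = (1 / 3 : ℝ) + (1 / 3 : ℝ) * ((1 - zeta) * z) := by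
  simp [segChart, childChart, child, conj_zeta]; ring

lemma childChart_two (z : ℂ) :
    childChart 2 z = (2 / 3 : ℝ) - (1 / 3 : ℝ) * zeta + (1 / 3 : ℝ) * (zeta * z) := by
  simp [segChart, childChart, child, conj_zeta]; ring

lemma childChart_three (z : ℂ) : childChart 3 z = (2 / 3 : ℝ) + (1 / 3 : ℝ) * z := by
  simp [segChart, childChart, child]; left; ring

/-- In the coordinates `re`, `height` the child maps are linear with rational coefficients, so
inclusions between triangles become problems for `linarith`. -/
lemma childChart_re (d : Fin 4) (z : ℂ) : (childChart d z).re =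
    ![z.re / 3, 1 / 3 + (z.re + 3 * height z) / 6, 1 / 2 + (z.re - 3 * height z) / 6,
      2 / 3 + z.re / 3] d := by
  fin_cases d
  · change (childChart 0 z).re = z.re / 3
    simp [childChart_zero]; ring
  · change (childChart 1 z).re = 1 / 3 + (z.re + 3 * height z) / 6
    simp only [childChart_one, Complex.add_re, Complex.ofReal_re, re_mul, height_ofReal,
      Complex.sub_re, height_sub, Complex.one_re, height_one, zeta_re, zeta_height]
    ring
  · change (childChart 2 z).re = 1 / 2 + (z.re - 3 * height z) / 6
    simp only [childChart_two, Complex.add_re, Complex.ofReal_re, re_mul, height_ofReal,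
      Complex.sub_re, zeta_re, zeta_height]
    ring
  · change (childChart 3 z).re = 2 / 3 + z.re / 3
    simp [childChart_three]; ring

lemma childChart_height (d : Fin 4) (z : ℂ) : height (childChart d z) =
    ![height z / 3, (height z - z.re) / 6, -(1 / 6) + (height z + z.re) / 6, height z / 3] d := by
  fin_cases d
  · change height (childChart 0 z) = height z / 3
    rw [childChart_zero, height_ofReal_mul]; ring
  · change height (childChart 1 z) = (height z - z.re) / 6
    simp only [childChart_one, height_add, height_ofReal, height_mul, height_sub, Complex.ofReal_re,
      Complex.sub_re, height_one, zeta_height, zeta_re, Complex.one_re]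
    ring
  · change height (childChart 2 z) = -(1 / 6) + (height z + z.re) / 6
    simp only [childChart_two, height_add, height_sub, height_ofReal, height_mul, Complex.ofReal_re,
      zeta_height, zeta_re]
    ring
  · change height (childChart 3 z) = height z / 3
    simp only [childChart_three, height_add, height_ofReal, height_ofReal_mul]
    ring

lemma chart_root_re (r : Fin 3) (z : ℂ) : (chart r [] z).re =
    ![z.re, 1 - (z.re + 3 * height z) / 2, 1 / 2 - (z.re - 3 * height z) / 2] r := by
  fin_cases r
  · simp [chart, segChart, side, rootSide]
  · simp [chart, segChart, side, rootSide, -Complex.mul_re, re_mul]; ring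
  · simp [chart, segChart, side, rootSide, -Complex.mul_re, re_mul]; ring

lemma chart_root_height (r : Fin 3) (z : ℂ) : height (chart r [] z) =
    ![height z, (z.re - height z) / 2, 1 / 2 - (z.re + height z) / 2] r := by
  fin_cases r
  · simp [chart, segChart, side, rootSide]
  · simp [chart, segChart, side, rootSide, height_mul]; ring
  · simp [chart, segChart, side, rootSide, height_mul]; ring

/-! ### Sides are unit steps of a triangular lattice -/

/-- The unit vector in the direction of a side. -/
def unitDir (r : Fin 3) (w : List (Fin 4)) : ℂ := 3 ^ w.length * ((side r w).2 - (side r w).1)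

lemma side_sub (r : Fin 3) (w : List (Fin 4)) :
    (side r w).2 - (side r w).1 = (1 / 3) ^ w.length * unitDir r w := by
  rw [unitDir, ← mul_assoc, ← mul_pow]; norm_num

lemma chart_eq (r : Fin 3) (w : List (Fin 4)) (z : ℂ) :
    chart r w z = (side r w).1 + (1 / 3) ^ w.length * unitDir r w * z := by
  rw [chart, segChart, side_sub]

lemma unitDir_cons (r : Fin 3) (d : Fin 4) (w : List (Fin 4)) :
    unitDir r (d :: w) = unitDir r w * ![1, 1 - zeta, zeta, 1] d := by
  fin_cases d <;> simp [unitDir, side, child, conj_zeta] <;> ring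

lemma unitDir_nil (r : Fin 3) : unitDir r [] = ![1, zeta ^ 2, zeta ^ 4] r := by
  fin_cases r
  · simp [unitDir, side, rootSide]
  · simp [unitDir, side, rootSide, zeta_sq]
  · simp [unitDir, side, rootSide]; linear_combination -zeta * zeta_pow_three

lemma one_sub_zeta : 1 - zeta = zeta ^ 5 := by
  linear_combination zeta_sq - zeta ^ 2 * zeta_pow_three

lemma exists_unitDir_eq_zeta_pow (r : Fin 3) (w : List (Fin 4)) : ∃ k : ℕ, unitDir r w = zeta ^ k := by
  induction w with
  | nil => rw [unitDir_nil]; fin_cases r; exacts [⟨0, rfl⟩, ⟨2, rfl⟩, ⟨4, rfl⟩]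
  | cons d w ih =>
    obtain ⟨k, hk⟩ := ih
    rw [unitDir_cons, hk]
    fin_cases d
    exacts [⟨k, by simp⟩, ⟨k + 5, by simp [one_sub_zeta, pow_add]⟩, ⟨k + 1, by simp [pow_succ]⟩,
      ⟨k, by simp⟩]

lemma zeta_pow_six : zeta ^ 6 = 1 := by
  linear_combination (zeta ^ 3 - 1) * zeta_pow_three

lemma unitDir_pow_six (r : Fin 3) (w : List (Fin 4)) : unitDir r w ^ 6 = 1 := by
  obtain ⟨k, hk⟩ := exists_unitDir_eq_zeta_pow r w
  rw [hk, ← pow_mul, mul_comm, pow_mul, zeta_pow_six, one_pow]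

lemma unitDir_ne_zero (r : Fin 3) (w : List (Fin 4)) : unitDir r w ≠ 0 := by
  intro h
  have := unitDir_pow_six r w
  simp [h] at this

lemma norm_unitDir (r : Fin 3) (w : List (Fin 4)) : ‖unitDir r w‖ = 1 :=
  Complex.norm_eq_one_of_pow_eq_one (unitDir_pow_six r w) (by norm_num)

lemma side_sub_ne_zero (r : Fin 3) (w : List (Fin 4)) : (side r w).2 - (side r w).1 ≠ 0 := by
  rw [side_sub]
  exact mul_ne_zero (pow_ne_zero _ (by norm_num)) (unitDir_ne_zero r w)

lemma norm_side_sub (r : Fin 3) (w : List (Fin 4)) :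
    ‖(side r w).2 - (side r w).1‖ = (1 / 3) ^ w.length := by
  rw [side_sub, norm_mul, norm_unitDir]; simp

lemma chart_injective (r : Fin 3) (w : List (Fin 4)) : Function.Injective (chart r w) := by
  intro y z h
  simpa [chart, segChart, side_sub_ne_zero r w] using h

lemma continuous_chart (r : Fin 3) (w : List (Fin 4)) : Continuous (chart r w) := by
  unfold chart segChart; fun_prop

lemma dist_chart (r : Fin 3) (w : List (Fin 4)) (y z : ℂ) :
    dist (chart r w y) (chart r w z) = (1 / 3) ^ w.length * dist y z := by
  rw [dist_eq_norm, dist_eq_norm, ← norm_side_sub r w, ← norm_mul]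
  congr 1; simp [chart, segChart]; ring

/-- The inverse of a chart. -/
def coord (r : Fin 3) (w : List (Fin 4)) (z : ℂ) : ℂ :=
  (z - (side r w).1) / ((side r w).2 - (side r w).1)

lemma continuous_coord (r : Fin 3) (w : List (Fin 4)) : Continuous (coord r w) := by
  unfold coord; fun_prop

@[simp] lemma chart_coord (r : Fin 3) (w : List (Fin 4)) (z : ℂ) : chart r w (coord r w z) = z := by
  have := side_sub_ne_zero r w
  simp only [chart, segChart, coord]
  field_simp
  ring

@[simp] lemma coord_chart (r : Fin 3) (w : List (Fin 4)) (z : ℂ) : coord r w (chart r w z) = z :=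
  chart_injective r w (chart_coord r w _)

lemma image_chart_mem_nhds {r : Fin 3} {w : List (Fin 4)} {s : Set ℂ} {z : ℂ} (hs : s ∈ 𝓝 z) :
    chart r w '' s ∈ 𝓝 (chart r w z) := by
  have h : coord r w ⁻¹' s ∈ 𝓝 (chart r w z) :=
    (continuous_coord r w).continuousAt (by simpa using hs)
  exact mem_of_superset h fun y hy => ⟨_, hy, chart_coord r w y⟩

lemma segment_eq_image_segChart (s : ℂ × ℂ) :
    segment ℝ s.1 s.2 = (fun t : ℝ => segChart s t) '' Icc 0 1 := by
  rw [segment_eq_image']; simp [segChart, mul_comm]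

lemma openSegment_eq_image_segChart (s : ℂ × ℂ) :
    openSegment ℝ s.1 s.2 = (fun t : ℝ => segChart s t) '' Ioo 0 1 := by
  rw [openSegment_eq_image']; simp [segChart, mul_comm]

lemma sideMid_eq (r : Fin 3) (w : List (Fin 4)) : sideMid r w = chart r w (1 / 2 : ℝ) := by
  simp [sideMid, chart, segChart, midpoint_eq_smul_add]; ring

lemma mem_KS {n : ℕ} {z : ℂ} : z ∈ KS n ↔ ∃ (r : Fin 3) (w : List (Fin 4)), w.length = n ∧
    ∃ t : ℝ, t ∈ Icc (0 : ℝ) 1 ∧ chart r w t = z := by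
  simp only [KS, segment_eq_image_segChart, mem_ofPred_eq, chart, mem_image]

/-! ### Hulls of sides -/

/-- The isosceles triangle spanned by the Koch curve over the unit interval, without its two vertices on the
real axis. -/
def hull : Set ℂ :=
  {z | height z ≤ 0 ∧ -3 * height z ≤ z.re ∧ -3 * height z ≤ 1 - z.re ∧ 0 < z.re ∧ z.re < 1}

/-- The triangle glued onto the unit interval. -/
def cell : Set ℂ := {z | height z ≤ 0 ∧ -height z ≤ z.re - 1 / 3 ∧ -height z ≤ 2 / 3 - z.re}

/-- The equilateral triangle on the unit interval, on the side of the table. -/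
def inner : Set ℂ := {z | 0 ≤ height z ∧ height z ≤ z.re ∧ height z ≤ 1 - z.re}

/-- The interior of the union of `cell` and `inner`. -/
def passage : Set ℂ :=
  {z | -height z < z.re - 1 / 3 ∧ -height z < 2 / 3 - z.re ∧ height z < z.re ∧ height z < 1 - z.re}

lemma cell_subset_hull : cell ⊆ hull := by
  rintro z ⟨h₁, h₂, h₃⟩
  refine ⟨h₁, ?_, ?_, ?_, ?_⟩ <;> linarith

lemma passage_subset : passage ⊆ cell ∪ inner := by
  rintro z ⟨h₁, h₂, h₃, h₄⟩
  rcases le_total (height z) 0 with h | h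
  · exact Or.inl ⟨h, h₁.le, h₂.le⟩
  · exact Or.inr ⟨h, h₃.le, h₄.le⟩

lemma isOpen_passage : IsOpen passage := by
  unfold passage
  refine IsOpen.and (isOpen_lt ?_ ?_) (IsOpen.and (isOpen_lt ?_ ?_)
    (IsOpen.and (isOpen_lt ?_ ?_) (isOpen_lt ?_ ?_))) <;> fun_prop

lemma isCompact_of_height_bound {s : Set ℂ} (hs : IsClosed s) {C : ℝ}
    (h : ∀ z ∈ s, |z.re| ≤ C ∧ |height z| ≤ C) : IsCompact s := by
  refine Metric.isCompact_of_isClosed_isBounded hs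
    (isBounded_iff_forall_norm_le.2 ⟨C + Real.sqrt 3 * C, fun z hz => ?_⟩)
  refine (Complex.norm_le_abs_re_add_abs_im z).trans ?_
  rw [im_eq_height z, abs_mul, abs_of_pos sqrt_three_pos]
  have := h z hz
  have := sqrt_three_pos
  gcongr <;> tauto

lemma isCompact_cell : IsCompact cell := by
  refine isCompact_of_height_bound (C := 1) ?_ ?_
  · unfold cell
    refine IsClosed.and (isClosed_le ?_ ?_) (IsClosed.and (isClosed_le ?_ ?_)
      (isClosed_le ?_ ?_)) <;> fun_prop
  · rintro z ⟨h₁, h₂, h₃⟩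
    constructor <;> rw [abs_le] <;> constructor <;> linarith

lemma isCompact_inner : IsCompact inner := by
  refine isCompact_of_height_bound (C := 1) ?_ ?_
  · unfold inner
    refine IsClosed.and (isClosed_le ?_ ?_) (IsClosed.and (isClosed_le ?_ ?_)
      (isClosed_le ?_ ?_)) <;> fun_prop
  · rintro z ⟨h₁, h₂, h₃⟩
    constructor <;> rw [abs_le] <;> constructor <;> linarith

lemma childChart_mem_hull (d : Fin 4) {z : ℂ} (hz : z ∈ hull) : childChart d z ∈ hull := by
  obtain ⟨h₁, h₂, h₃, h₄, h₅⟩ := hz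
  have hr := childChart_re d z
  have hh := childChart_height d z
  fin_cases d <;> simp at hr hh <;> refine ⟨?_, ?_, ?_, ?_, ?_⟩ <;> simp [hr, hh] <;> linarith

/-- Triangles over neighbouring children touch only at the common end point of the two sides, which
`hull` excludes. -/
lemma childChart_hull_disjoint {d d' : Fin 4} {z z' : ℂ} (hz : z ∈ hull) (hz' : z' ∈ hull)
    (h : childChart d z = childChart d' z') : d = d' := by
  obtain ⟨h₁, h₂, h₃, h₄, h₅⟩ := hz
  obtain ⟨h₁', h₂', h₃', h₄', h₅'⟩ := hz'
  have hr := childChart_re d z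
  have hh := childChart_height d z
  rw [h] at hr hh
  rw [childChart_re] at hr
  rw [childChart_height] at hh
  fin_cases d <;> fin_cases d' <;> simp at hr hh ⊢ <;> linarith

lemma chart_root_hull_disjoint {r r' : Fin 3} {z z' : ℂ} (hz : z ∈ hull) (hz' : z' ∈ hull)
    (h : chart r [] z = chart r' [] z') : r = r' := by
  obtain ⟨h₁, h₂, h₃, h₄, h₅⟩ := hz
  obtain ⟨h₁', h₂', h₃', h₄', h₅'⟩ := hz'
  have hr := chart_root_re r z
  have hh := chart_root_height r z
  rw [h] at hr hh
  rw [chart_root_re] at hr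
  rw [chart_root_height] at hh
  fin_cases r <;> fin_cases r' <;> simp at hr hh ⊢ <;> linarith

/-- Hulls of distinct sides of a prefractal are disjoint. -/
lemma address_eq_of_hull {r r' : Fin 3} {w w' : List (Fin 4)} (hw : w.length = w'.length)
    {z z' : ℂ} (hz : z ∈ hull) (hz' : z' ∈ hull) (h : chart r w z = chart r' w' z') :
    r = r' ∧ w = w' := by
  induction w generalizing w' z z' with
  | nil =>
    obtain rfl : w' = [] := by simpa using hw.symm
    exact ⟨chart_root_hull_disjoint hz hz' h, rfl⟩
  | cons d w ih =>
    obtain _ | ⟨d', w'⟩ := w'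
    · simp at hw
    rw [chart_cons, chart_cons] at h
    obtain ⟨rfl, rfl⟩ := ih (by simpa using hw) (childChart_mem_hull d hz)
      (childChart_mem_hull d' hz') h
    rw [childChart_hull_disjoint hz hz' (chart_injective _ _ h)]
    exact ⟨rfl, rfl⟩

lemma ofReal_mem_hull {t : ℝ} (ht : t ∈ Ioo (0 : ℝ) 1) : (t : ℂ) ∈ hull := by
  obtain ⟨h₁, h₂⟩ := ht
  refine ⟨?_, ?_, ?_, ?_, ?_⟩ <;> simp <;> linarith

lemma half_mem_hull : ((1 / 2 : ℝ) : ℂ) ∈ hull := ofReal_mem_hull (by norm_num)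

/-! ### The billiard tables -/

/-- The closed region bounded by `KS_n`. -/
def table : ℕ → Set ℂ
  | 0 => inner
  | n + 1 => table n ∪ {z | ∃ (r : Fin 3) (w : List (Fin 4)), w.length = n ∧ ∃ y ∈ cell, chart r w y = z}

lemma table_subset_succ (n : ℕ) : table n ⊆ table (n + 1) := subset_union_left

lemma table_mono : Monotone table := monotone_nat_of_le_succ table_subset_succ

lemma chart_cell_mem_table (r : Fin 3) (w : List (Fin 4)) {z : ℂ} (hz : z ∈ cell) :
    chart r w z ∈ table (w.length + 1) := Or.inr ⟨r, w, rfl, z, hz, rfl⟩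

/-- For the outer thirds the inner triangle shrinks into the parent's; for the two new sides it lies
in the cell just glued on. -/
lemma chart_inner_mem_table (r : Fin 3) (w : List (Fin 4)) {z : ℂ} (hz : z ∈ inner) :
    chart r w z ∈ table w.length := by
  induction w generalizing z with
  | nil =>
    obtain ⟨h₁, h₂, h₃⟩ := hz
    have hr := chart_root_re r z
    have hh := chart_root_height r z
    fin_cases r <;> simp at hr hh <;> refine ⟨?_, ?_, ?_⟩ <;> simp [hr, hh] <;> linarith
  | cons d w ih =>
    rw [chart_cons]
    suffices h : childChart d z ∈ inner ∨ childChart d z ∈ cell by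
      rcases h with h | h
      exacts [table_subset_succ _ (ih h), chart_cell_mem_table r w h]
    obtain ⟨h₁, h₂, h₃⟩ := hz
    have hr := childChart_re d z
    have hh := childChart_height d z
    fin_cases d
    · left; refine ⟨?_, ?_, ?_⟩ <;> simp at hr hh ⊢ <;> linarith
    · right; refine ⟨?_, ?_, ?_⟩ <;> simp at hr hh ⊢ <;> linarith
    · right; refine ⟨?_, ?_, ?_⟩ <;> simp at hr hh ⊢ <;> linarith
    · left; refine ⟨?_, ?_, ?_⟩ <;> simp at hr hh ⊢ <;> linarith

lemma childChart_height_neg (d : Fin 4) {z : ℂ} (hz : z ∈ hull) (h : height z < 0) :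
    height (childChart d z) < 0 := by
  obtain ⟨h₁, h₂, h₃, h₄, h₅⟩ := hz
  rw [childChart_height]
  fin_cases d <;> simp <;> linarith

lemma childChart_notMem_cell (d : Fin 4) {z : ℂ} (hz : z ∈ hull) (h : height z < 0) :
    childChart d z ∉ cell := by
  rintro ⟨c₁, c₂, c₃⟩
  obtain ⟨h₁, h₂, h₃, h₄, h₅⟩ := hz
  have hr := childChart_re d z
  have hh := childChart_height d z
  fin_cases d <;> simp at hr hh c₁ c₂ c₃ <;> linarith

/-- The hull of a side meets the table only in the side. -/
lemma chart_notMem_table (r : Fin 3) (w : List (Fin 4)) {z : ℂ} (hz : z ∈ hull)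
    (h : height z < 0) : chart r w z ∉ table w.length := by
  induction w generalizing z with
  | nil =>
    rintro ⟨c₁, c₂, c₃⟩
    obtain ⟨h₁, h₂, h₃, h₄, h₅⟩ := hz
    rw [chart_root_re] at c₂ c₃
    rw [chart_root_height] at c₁ c₂ c₃
    fin_cases r <;> simp at c₁ c₂ c₃ <;> linarith
  | cons d w ih =>
    rw [chart_cons]
    -- If the point lies in a newly glued cell, disjointness of hulls forces that cell to sit over
    -- `w` itself; but hull points of negative height over a child avoid that cell.
    rintro (hm | ⟨r', w', hw, y, hy, he⟩)
    · exact ih (childChart_mem_hull d hz) (childChart_height_neg d hz h) hm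
    · obtain ⟨rfl, rfl⟩ := address_eq_of_hull hw (cell_subset_hull hy) (childChart_mem_hull d hz) he
      rw [chart_injective _ _ he] at hy
      exact childChart_notMem_cell d hz h hy

lemma mem_cell_of_chart_mem_table {r : Fin 3} {w : List (Fin 4)} {z : ℂ} (hz : z ∈ hull)
    (h : height z < 0) (hm : chart r w z ∈ table (w.length + 1)) : z ∈ cell := by
  rcases hm with hm | ⟨r', w', hw, y, hy, he⟩
  · exact absurd hm (chart_notMem_table r w hz h)
  · obtain ⟨rfl, rfl⟩ := address_eq_of_hull hw (cell_subset_hull hy) hz he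
    rwa [chart_injective _ _ he] at hy

/-- Gluing a cell opens the middle third of its base: trajectories may cross there without meeting
the new curve. -/
lemma chart_passage_mem_interior (r : Fin 3) (w : List (Fin 4)) {z : ℂ} (hz : z ∈ passage) :
    chart r w z ∈ interior (table (w.length + 1)) := by
  rw [mem_interior_iff_mem_nhds]
  refine mem_of_superset (image_chart_mem_nhds (isOpen_passage.mem_nhds hz)) ?_
  rintro _ ⟨y, hy, rfl⟩
  rcases passage_subset hy with h | h
  exacts [chart_cell_mem_table r w h, table_subset_succ _ (chart_inner_mem_table r w h)]

lemma chart_mem_KS (r : Fin 3) (w : List (Fin 4)) {t : ℝ} (ht : t ∈ Icc (0 : ℝ) 1) :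
    chart r w t ∈ KS w.length := mem_KS.2 ⟨r, w, rfl, t, ht, rfl⟩

lemma chart_childChart_mem_KS (r : Fin 3) (w : List (Fin 4)) (d : Fin 4) {t : ℝ}
    (ht : t ∈ Icc (0 : ℝ) 1) : chart r w (childChart d t) ∈ KS (w.length + 1) := by
  rw [← chart_cons]; exact chart_mem_KS r (d :: w) ht

lemma mem_passage_or_of_mem_cell {z : ℂ} (hz : z ∈ cell) :
    z ∈ passage ∨ ∃ d : Fin 4, ∃ t ∈ Icc (0 : ℝ) 1, childChart d t = z := by
  obtain ⟨h₁, h₂, h₃⟩ := hz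
  rcases h₂.lt_or_eq with h₂ | h₂
  · rcases h₃.lt_or_eq with h₃ | h₃
    · exact Or.inl ⟨h₂, h₃, by linarith, by linarith⟩
    · refine Or.inr ⟨2, 6 * z.re - 3, ⟨by linarith, by linarith⟩, ext_height ?_ ?_⟩
      · simp only [childChart_re, Complex.ofReal_re, height_ofReal]; simp; ring
      · simp only [childChart_height, Complex.ofReal_re, height_ofReal]; simp; linarith
  · refine Or.inr ⟨1, 6 * z.re - 2, ⟨by linarith, by linarith⟩, ext_height ?_ ?_⟩
    · simp only [childChart_re, Complex.ofReal_re, height_ofReal]; simp; ring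
    · simp only [childChart_height, Complex.ofReal_re, height_ofReal]; simp; linarith

lemma mem_passage_or_of_mem_Icc {t : ℝ} (ht : t ∈ Icc (0 : ℝ) 1) :
    (t : ℂ) ∈ passage ∨ ∃ d : Fin 4, ∃ t' ∈ Icc (0 : ℝ) 1, childChart d t' = t := by
  obtain ⟨h₁, h₂⟩ := ht
  rcases le_or_gt t (1 / 3) with h | h
  · refine Or.inr ⟨0, 3 * t, ⟨by linarith, by linarith⟩, ext_height ?_ ?_⟩
    · simp only [childChart_re, Complex.ofReal_re, height_ofReal]; simp
    · simp only [childChart_height, height_ofReal]; simp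
  rcases lt_or_ge t (2 / 3) with h' | h'
  · left; refine ⟨?_, ?_, ?_, ?_⟩ <;> simp <;> linarith
  · refine Or.inr ⟨3, 3 * t - 2, ⟨by linarith, by linarith⟩, ext_height ?_ ?_⟩
    · simp only [childChart_re, Complex.ofReal_re, height_ofReal]; simp; ring
    · simp only [childChart_height, height_ofReal]; simp

/-- The frontier of the table is contained in the curve. -/
lemma mem_interior_table {n : ℕ} {z : ℂ} (hz : z ∈ table n) (h : z ∉ KS n) :
    z ∈ interior (table n) := by
  induction n with
  | zero =>
    obtain ⟨h₁, h₂, h₃⟩ := hz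
    have key : 0 < height z ∧ height z < z.re ∧ height z < 1 - z.re := by
      refine ⟨h₁.lt_of_ne fun e => h ?_, h₂.lt_of_ne fun e => h ?_, h₃.lt_of_ne fun e => h ?_⟩
      · refine mem_KS.2 ⟨0, [], rfl, z.re, ⟨by linarith, by linarith⟩, ext_height ?_ ?_⟩
        · simp only [chart_root_re, Complex.ofReal_re, height_ofReal]; simp
        · simp only [chart_root_height, Complex.ofReal_re, height_ofReal]; simp; linarith
      · refine mem_KS.2 ⟨2, [], rfl, 1 - 2 * z.re, ⟨by linarith, by linarith⟩, ext_height ?_ ?_⟩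
        · simp only [chart_root_re, Complex.ofReal_re, height_ofReal]; simp; ring
        · simp only [chart_root_height, Complex.ofReal_re, height_ofReal]; simp; linarith
      · refine mem_KS.2 ⟨1, [], rfl, 2 - 2 * z.re, ⟨by linarith, by linarith⟩, ext_height ?_ ?_⟩
        · simp only [chart_root_re, Complex.ofReal_re, height_ofReal]; simp; ring
        · simp only [chart_root_height, Complex.ofReal_re, height_ofReal]; simp; linarith
    have ho : IsOpen {z : ℂ | 0 < height z ∧ height z < z.re ∧ height z < 1 - z.re} := by
      refine IsOpen.and (isOpen_lt ?_ ?_) (IsOpen.and (isOpen_lt ?_ ?_)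
        (isOpen_lt ?_ ?_)) <;> fun_prop
    exact mem_interior.2 ⟨_, fun y hy => ⟨hy.1.le, hy.2.1.le, hy.2.2.le⟩, ho, key⟩
  | succ n ih =>
    rcases hz with hz | ⟨r, w, rfl, y, hy, rfl⟩
    · by_cases hK : z ∈ KS n
      -- A point of the old curve off the new one lies in an open middle third, where a cell has
      -- been glued.
      · obtain ⟨r, w, rfl, t, ht, rfl⟩ := mem_KS.1 hK
        rcases mem_passage_or_of_mem_Icc ht with hp | ⟨d, t', ht', e⟩
        · exact chart_passage_mem_interior r w hp
        · exact absurd (e ▸ chart_childChart_mem_KS r w d ht') h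
      · exact interior_mono (table_subset_succ n) (ih hz hK)
    · rcases mem_passage_or_of_mem_cell hy with hp | ⟨d, t', ht', rfl⟩
      · exact chart_passage_mem_interior r w hp
      · exact absurd (chart_childChart_mem_KS r w d ht') h

/-- The isosceles triangle spanned by the Koch curve over the unit interval. -/
def closedHull : Set ℂ := {z | height z ≤ 0 ∧ -3 * height z ≤ z.re ∧ -3 * height z ≤ 1 - z.re}

lemma ofReal_mem_closedHull {t : ℝ} (ht : t ∈ Icc (0 : ℝ) 1) : (t : ℂ) ∈ closedHull := by
  obtain ⟨h₁, h₂⟩ := ht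
  refine ⟨?_, ?_, ?_⟩ <;> simp <;> linarith

lemma hull_subset_closedHull : hull ⊆ closedHull := fun _ h => ⟨h.1, h.2.1, h.2.2.1⟩

lemma chart_closedHull_notMem_interior (r : Fin 3) (w : List (Fin 4)) {z : ℂ}
    (hz : z ∈ closedHull) : chart r w z ∉ interior (table w.length) := by
  intro h
  rw [mem_interior_iff_mem_nhds] at h
  -- `c` is halfway from the base to the apex of the hull. Moving from `z` slightly towards it
  -- enters the hull at negative height, which is outside the table.
  set c : ℂ := (1 / 2 : ℝ) - (1 / 6 : ℝ) * zeta + (1 / 12 : ℝ) with hc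
  have cre : c.re = 1 / 2 := by
    simp only [hc, Complex.add_re, Complex.sub_re, Complex.ofReal_re, re_mul, height_ofReal, zeta_re]
    norm_num
  have cht : height c = -(1 / 12) := by
    simp only [hc, height_add, height_sub, height_ofReal_mul, height_ofReal, zeta_height]
    norm_num
  have ht : Tendsto (fun ε : ℝ => chart r w (z + ε * (c - z))) (𝓝[>] 0) (𝓝 (chart r w z)) := by
    have : Continuous fun ε : ℝ => chart r w (z + ε * (c - z)) :=
      (continuous_chart r w).comp (by fun_prop)
    simpa using (this.tendsto 0).mono_left nhdsWithin_le_nhds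
  obtain ⟨ε, he, h₀, h₁⟩ := ((ht.eventually h).and (Ioo_mem_nhdsGT one_pos)).exists
  obtain ⟨h₂, h₃, h₄⟩ := hz
  have hre : (z + ε * (c - z)).re = z.re + ε * (1 / 2 - z.re) := by
    simp [re_mul, -Complex.mul_re, cre]
  have hht : height (z + ε * (c - z)) = height z + ε * (-(1 / 12) - height z) := by
    simp [cht]
  refine chart_notMem_table r w ?_ ?_ he
  · refine ⟨?_, ?_, ?_, ?_, ?_⟩ <;> simp only [hre, hht] <;> nlinarith
  · rw [hht]; nlinarith

lemma notMem_interior_table_of_mem_KS {n : ℕ} {z : ℂ} (hz : z ∈ KS n) : z ∉ interior (table n) := by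
  obtain ⟨r, w, rfl, t, ht, rfl⟩ := mem_KS.1 hz
  exact chart_closedHull_notMem_interior r w (ofReal_mem_closedHull ht)

lemma notMem_interior_table_of_mem_KS_succ {n : ℕ} {z : ℂ} (hz : z ∈ KS (n + 1)) :
    z ∉ interior (table n) := fun h =>
  notMem_interior_table_of_mem_KS hz (interior_mono (table_subset_succ n) h)

lemma finite_words (n : ℕ) : {a : Fin 3 × List (Fin 4) | a.2.length = n}.Finite :=
  (finite_univ.prod (List.finite_length_eq (Fin 4) n)).subset fun _ h => ⟨trivial, h⟩

lemma isCompact_table (n : ℕ) : IsCompact (table n) := by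
  induction n with
  | zero => exact isCompact_inner
  | succ n ih =>
    refine ih.union ?_
    have := (finite_words n).isCompact_biUnion
      fun a _ => isCompact_cell.image (continuous_chart a.1 a.2)
    convert this using 1
    ext z; simp

lemma isClosed_KS (n : ℕ) : IsClosed (KS n) := by
  have := (finite_words n).isCompact_biUnion
    fun a _ => (isCompact_Icc (a := (0 : ℝ)) (b := 1)).image
      ((continuous_chart a.1 a.2).comp Complex.continuous_ofReal)
  convert this.isClosed using 1
  ext z; simp [mem_KS]

/-! ### Trajectories inside the table -/

/-- A vector in the coordinates of a side. -/
def localDir (r : Fin 3) (w : List (Fin 4)) (v : ℂ) : ℂ := v / ((side r w).2 - (side r w).1)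

lemma chart_add (r : Fin 3) (w : List (Fin 4)) (z v : ℂ) :
    chart r w z + v = chart r w (z + localDir r w v) := by
  have := side_sub_ne_zero r w
  simp only [chart, segChart, localDir]
  field_simp
  ring

lemma localDir_neg (r : Fin 3) (w : List (Fin 4)) (v : ℂ) :
    localDir r w (-v) = -localDir r w v := neg_div _ _

lemma localDir_ofReal_mul (r : Fin 3) (w : List (Fin 4)) (t : ℝ) (v : ℂ) :
    localDir r w (t * v) = t * localDir r w v := mul_div_assoc _ _ _

lemma height_localDir_pos_iff {r : Fin 3} {w : List (Fin 4)} {v : ℂ} :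
    0 < height (localDir r w v) ↔ 0 < ((starRingEnd ℂ) ((side r w).2 - (side r w).1) * v).im := by
  set a := (side r w).2 - (side r w).1 with ha
  have h0 : a ≠ 0 := side_sub_ne_zero r w
  have h1 : (starRingEnd ℂ) a * v = (Complex.normSq a : ℝ) * localDir r w v := by
    rw [localDir, ← ha, Complex.normSq_eq_conj_mul_self]; field_simp
  rw [h1, Complex.im_ofReal_mul, im_eq_height]
  simp [h0]

lemma isInward_iff {n : ℕ} {x θ : ℂ} : IsInward n x θ ↔ ∃ (r : Fin 3) (w : List (Fin 4)),
    w.length = n ∧ ∃ t : ℝ, t ∈ Ioo (0 : ℝ) 1 ∧ chart r w t = x ∧ 0 < height (localDir r w θ) := by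
  simp only [IsInward, openSegment_eq_image_segChart, mem_image, height_localDir_pos_iff, chart]
  aesop

lemma eventually_mem_interior_table (r : Fin 3) (w : List (Fin 4)) {t : ℝ} (ht : t ∈ Ioo (0 : ℝ) 1)
    {v : ℂ} (hv : 0 < height (localDir r w v)) :
    ∀ᶠ ε : ℝ in 𝓝[>] 0, chart r w t + ε * v ∈ interior (table w.length) := by
  have h₂ : ∀ᶠ ε : ℝ in 𝓝 0, height (t + ε * localDir r w v) < (t + ε * localDir r w v).re := by
    refine ContinuousAt.eventually_lt (by fun_prop) (by fun_prop) ?_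
    simpa using ht.1
  have h₃ : ∀ᶠ ε : ℝ in 𝓝 0, height (t + ε * localDir r w v) < 1 - (t + ε * localDir r w v).re := by
    refine ContinuousAt.eventually_lt (by fun_prop) (by fun_prop) ?_
    simpa using ht.2
  filter_upwards [nhdsWithin_le_nhds h₂, nhdsWithin_le_nhds h₃, self_mem_nhdsWithin] with ε h₂ h₃ h₁
  have ho : IsOpen {z : ℂ | 0 < height z ∧ height z < z.re ∧ height z < 1 - z.re} := by
    refine IsOpen.and (isOpen_lt ?_ ?_) (IsOpen.and (isOpen_lt ?_ ?_)
      (isOpen_lt ?_ ?_)) <;> fun_prop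
  rw [mem_interior_iff_mem_nhds, chart_add, localDir_ofReal_mul]
  refine mem_of_superset (image_chart_mem_nhds (ho.mem_nhds ⟨?_, h₂, h₃⟩)) ?_
  · simpa using mul_pos h₁ hv
  · rintro _ ⟨y, hy, rfl⟩
    exact chart_inner_mem_table r w ⟨hy.1.le, hy.2.1.le, hy.2.2.le⟩

lemma eventually_mem_hull {t : ℝ} (ht : t ∈ Ioo (0 : ℝ) 1) {v : ℂ} (hv : height v < 0) :
    ∀ᶠ ε : ℝ in 𝓝[>] 0, (t + ε * v : ℂ) ∈ hull ∧ height (t + ε * v : ℂ) < 0 := by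
  have h₂ : ∀ᶠ ε : ℝ in 𝓝 0, -3 * height (t + ε * v) < (t + ε * v : ℂ).re := by
    refine ContinuousAt.eventually_lt (by fun_prop) (by fun_prop) ?_
    simpa using ht.1
  have h₃ : ∀ᶠ ε : ℝ in 𝓝 0, -3 * height (t + ε * v) < 1 - (t + ε * v : ℂ).re := by
    refine ContinuousAt.eventually_lt (by fun_prop) (by fun_prop) ?_
    simpa using ht.2
  filter_upwards [nhdsWithin_le_nhds h₂, nhdsWithin_le_nhds h₃, self_mem_nhdsWithin] with ε h₂ h₃ h₁
  have h₄ : height (t + ε * v) < 0 := by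
    simpa using mul_neg_of_pos_of_neg h₁ hv
  exact ⟨⟨h₄.le, h₂.le, h₃.le, by linarith, by linarith⟩, h₄⟩

lemma eventually_notMem_table (r : Fin 3) (w : List (Fin 4)) {t : ℝ} (ht : t ∈ Ioo (0 : ℝ) 1)
    {v : ℂ} (hv : height (localDir r w v) < 0) :
    ∀ᶠ ε : ℝ in 𝓝[>] 0, chart r w t + ε * v ∉ table w.length := by
  filter_upwards [eventually_mem_hull ht hv] with ε h
  rw [chart_add, localDir_ofReal_mul]
  exact chart_notMem_table r w h.1 h.2

/-- A trajectory stays inside the table as long as it does not meet the curve. -/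
lemma mem_interior_of_forall_notMem {n : ℕ} {x v : ℂ} {a b : ℝ}
    (h : ∀ t ∈ Ioo a b, x + t * v ∉ KS n) {t₀ : ℝ} (ht₀ : t₀ ∈ Ioo a b)
    (hi : x + t₀ * v ∈ table n) {t : ℝ} (ht : t ∈ Ioo a b) :
    x + t * v ∈ interior (table n) := by
  have hc : IsPreconnected ((fun t : ℝ => x + t * v) '' Ioo a b) :=
    isPreconnected_Ioo.image _ (by fun_prop)
  -- Off the curve the table has no frontier points, so its interior and its complement separate the
  -- connected path.
  refine hc.subset_left_of_subset_union (v := (table n)ᶜ) isOpen_interior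
    (isCompact_table n).isClosed.isOpen_compl ?_ ?_ ?_ (mem_image_of_mem _ ht)
  · exact disjoint_left.2 fun z h₁ h₂ => h₂ (interior_subset h₁)
  · rintro _ ⟨s, hs, rfl⟩
    by_cases hm : x + s * v ∈ table n
    exacts [Or.inl (mem_interior_table hm (h s hs)), Or.inr hm]
  · exact ⟨_, mem_image_of_mem _ ht₀, mem_interior_table hi (h t₀ ht₀)⟩

/-- A trajectory launched into the table hits the curve. -/
lemma exists_first_hit (r : Fin 3) (w : List (Fin 4)) {t : ℝ} (ht : t ∈ Ioo (0 : ℝ) 1) {v : ℂ}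
    (hv : 0 < height (localDir r w v)) :
    ∃ τ : ℝ, 0 < τ ∧ chart r w t + τ * v ∈ KS w.length ∧
      ∀ s ∈ Ioo 0 τ, chart r w t + s * v ∈ interior (table w.length) := by
  set x := chart r w t
  have hev := eventually_mem_interior_table r w ht hv
  obtain ⟨δ, hδ, hδi⟩ := mem_nhdsGT_iff_exists_Ioo_subset.1 hev
  have hδ : 0 < δ := hδ
  have hmem : ∀ s ∈ Ioo 0 δ, x + s * v ∈ interior (table w.length) := fun s hs => hδi hs
  have hv0 : v ≠ 0 := by rintro rfl; simp [localDir] at hv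
  -- At time 0 the trajectory is on the curve. Discarding the times below `δ`, when it is known to
  -- be inside, makes the set of collision times closed, so that its infimum is attained.
  set S : Set ℝ := {s | δ ≤ s ∧ x + s * v ∈ KS w.length}
  have hS : IsClosed S := by
    refine isClosed_Ici.inter ((isClosed_KS w.length).preimage ?_)
    fun_prop
  have hne : S.Nonempty := by
    by_contra hne
    have hno : ∀ s : ℝ, 0 < s → x + s * v ∉ KS w.length := by
      intro s hs hK
      rcases lt_or_ge s δ with h | h
      · exact notMem_interior_table_of_mem_KS hK (hmem s ⟨hs, h⟩)
      · exact hne ⟨s, h, hK⟩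
    obtain ⟨C, hC⟩ := isBounded_iff_forall_norm_le.1 (isCompact_table w.length).isBounded
    -- A time by which the trajectory would have left the ball of radius `C` containing the table.
    set T := δ + (‖x‖ + |C| + 1) / ‖v‖ with hT
    have hv' : 0 < ‖v‖ := norm_pos_iff.2 hv0
    have hTδ : δ < T := by rw [hT]; have : 0 < (‖x‖ + |C| + 1) / ‖v‖ := by positivity
                           linarith
    have hin := mem_interior_of_forall_notMem (n := w.length) (x := x) (v := v) (a := 0)
      (b := T + 1) (fun s hs => hno s hs.1) (t₀ := δ / 2) ⟨by linarith, by linarith⟩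
      (interior_subset (hmem _ ⟨by linarith, by linarith⟩)) (t := T) ⟨by linarith, by linarith⟩
    have h₁ := hC _ (interior_subset hin)
    have h₂ : ‖(T : ℂ) * v‖ ≤ ‖x + T * v‖ + ‖x‖ := by
      have := norm_sub_le (x + T * v) x
      simpa using this
    have h₃ : ‖(T : ℂ) * v‖ = δ * ‖v‖ + (‖x‖ + |C| + 1) := by
      rw [norm_mul, Complex.norm_real, Real.norm_of_nonneg (by linarith), hT]
      field_simp
    have := le_abs_self C
    have : 0 < δ * ‖v‖ := by positivity
    linarith
  have hb : BddBelow S := ⟨δ, fun s hs => hs.1⟩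
  have hτ := hS.csInf_mem hne hb
  refine ⟨sInf S, hδ.trans_le hτ.1, hτ.2, fun s hs => ?_⟩
  refine mem_interior_of_forall_notMem (a := 0) (b := sInf S) (fun s hs hK => ?_)
    (t₀ := δ / 2) ⟨by linarith, by linarith [hτ.1]⟩
    (interior_subset (hmem _ ⟨by linarith, by linarith⟩)) hs
  rcases lt_or_ge s δ with h | h
  · exact notMem_interior_table_of_mem_KS hK (hmem s ⟨hs.1, h⟩)
  · exact (csInf_le hb ⟨h, hK⟩).not_gt hs.2

/-! ### Launching from midpoints in lattice directions -/

/-- Among the two inward lattice directions at a side, the one whose cube is `σ`. -/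
def launch (σ : ℂ) (r : Fin 3) (w : List (Fin 4)) : ℂ :=
  open Classical in
  if unitDir r w ^ 3 = σ then zeta ^ 2 * unitDir r w else zeta * unitDir r w

/-- The point of the phase space at the midpoint of a side with direction `launch σ`. -/
def phase (σ : ℂ) (r : Fin 3) (w : List (Fin 4)) : ℂ × ℂ := (sideMid r w, launch σ r w)

lemma unitDir_pow_three (r : Fin 3) (w : List (Fin 4)) {σ : ℂ} (hσ : σ ^ 2 = 1) :
    unitDir r w ^ 3 = σ ∨ unitDir r w ^ 3 = -σ := by
  rw [← sq_eq_sq_iff_eq_or_eq_neg, hσ, ← pow_mul, unitDir_pow_six]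

lemma ne_neg_of_sq {σ : ℂ} (hσ : σ ^ 2 = 1) : -σ ≠ σ := by
  intro h
  have : σ = 0 := by linear_combination -h / 2
  simp [this] at hσ

lemma launch_of_pos {σ : ℂ} {r : Fin 3} {w : List (Fin 4)} (h : unitDir r w ^ 3 = σ) :
    launch σ r w = zeta ^ 2 * unitDir r w := if_pos h

lemma launch_of_neg {σ : ℂ} (hσ : σ ^ 2 = 1) {r : Fin 3} {w : List (Fin 4)}
    (h : unitDir r w ^ 3 = -σ) : launch σ r w = zeta * unitDir r w :=
  if_neg (h ▸ ne_neg_of_sq hσ)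

lemma launch_eq_or (σ : ℂ) (r : Fin 3) (w : List (Fin 4)) :
    launch σ r w = zeta * unitDir r w ∨ launch σ r w = zeta ^ 2 * unitDir r w := by
  unfold launch; split_ifs <;> simp

lemma launch_pow_three {σ : ℂ} (hσ : σ ^ 2 = 1) (r : Fin 3) (w : List (Fin 4)) :
    launch σ r w ^ 3 = σ := by
  rcases unitDir_pow_three r w hσ with h | h
  · rw [launch_of_pos h, mul_pow, h, ← pow_mul, zeta_pow_six, one_mul]
  · rw [launch_of_neg hσ h, mul_pow, h, zeta_pow_three, neg_mul_neg, one_mul]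

/-- With `u` the unit vector of the side, the inward lattice directions ζu and ζ²u have the opposite
cubes -u³ and u³, so the cube selects one of them. -/
lemma eq_launch {σ : ℂ} (hσ : σ ^ 2 = 1) {r : Fin 3} {w : List (Fin 4)} {v : ℂ}
    (hv : v = zeta * unitDir r w ∨ v = zeta ^ 2 * unitDir r w) (h : v ^ 3 = σ) :
    v = launch σ r w := by
  rcases hv with rfl | rfl
  · rw [mul_pow, zeta_pow_three] at h
    rw [launch_of_neg hσ (by linear_combination -h)]
  · rw [mul_pow, ← pow_mul, zeta_pow_six, one_mul] at h
    rw [launch_of_pos h]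

lemma norm_zeta : ‖zeta‖ = 1 := Complex.norm_eq_one_of_pow_eq_one zeta_pow_six (by norm_num)

lemma norm_launch (σ : ℂ) (r : Fin 3) (w : List (Fin 4)) : ‖launch σ r w‖ = 1 := by
  rcases launch_eq_or σ r w with h | h <;> simp [h, norm_zeta, norm_unitDir]

lemma localDir_mul_unitDir (r : Fin 3) (w : List (Fin 4)) (c : ℂ) :
    localDir r w (c * unitDir r w) = (3 ^ w.length : ℝ) * c := by
  have := unitDir_ne_zero r w
  rw [localDir, side_sub]
  push_cast
  rw [div_eq_iff (mul_ne_zero (pow_ne_zero _ (by norm_num)) this)]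
  have h : (3 : ℂ) ^ w.length * (1 / 3) ^ w.length = 1 := by rw [← mul_pow]; norm_num
  linear_combination -(c * unitDir r w) * h

@[simp] lemma zeta_sq_re : (zeta ^ 2).re = -(1 / 2) := by
  rw [zeta_sq]; simp; norm_num

@[simp] lemma zeta_sq_height : height (zeta ^ 2) = 1 / 2 := by
  rw [zeta_sq]; simp

lemma height_localDir_launch_pos (σ : ℂ) (r : Fin 3) (w : List (Fin 4)) :
    0 < height (localDir r w (launch σ r w)) := by
  rcases launch_eq_or σ r w with h | h <;> rw [h, localDir_mul_unitDir, height_ofReal_mul] <;>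
    simp

lemma sideMid_add (r : Fin 3) (w : List (Fin 4)) (t : ℝ) (c : ℂ) :
    sideMid r w + t * (c * unitDir r w) =
      chart r w ((1 / 2 : ℝ) + (t * 3 ^ w.length : ℝ) * c) := by
  rw [sideMid_eq, chart_add, localDir_ofReal_mul, localDir_mul_unitDir]
  push_cast
  ring_nf

/-! ### Collisions occur at midpoints -/

lemma mem_closure_zeta {z : ℂ} (hz : z ∈ Subring.closure {zeta}) :
    ∃ m k : ℤ, z = m + k * zeta := by
  induction hz using Subring.closure_induction with
  | mem x hx => exact ⟨0, 1, by simp_all⟩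
  | zero => exact ⟨0, 0, by simp⟩
  | one => exact ⟨1, 0, by simp⟩
  | add x y _ _ hx hy =>
    obtain ⟨m, k, rfl⟩ := hx
    obtain ⟨m', k', rfl⟩ := hy
    exact ⟨m + m', k + k', by push_cast; ring⟩
  | neg x _ hx =>
    obtain ⟨m, k, rfl⟩ := hx
    exact ⟨-m, -k, by push_cast; ring⟩
  | mul x y _ _ hx hy =>
    obtain ⟨m, k, rfl⟩ := hx
    obtain ⟨m', k', rfl⟩ := hy
    exact ⟨m * m' - k * k', m * k' + k * m' + k * k', by
      push_cast; linear_combination (k * k' : ℂ) * zeta_sq⟩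

lemma zeta_mem : zeta ∈ Subring.closure {zeta} := Subring.subset_closure rfl

lemma unitDir_mem (r : Fin 3) (w : List (Fin 4)) : unitDir r w ∈ Subring.closure {zeta} := by
  obtain ⟨k, hk⟩ := exists_unitDir_eq_zeta_pow r w
  exact hk ▸ pow_mem zeta_mem k

lemma side_mem (r : Fin 3) (w : List (Fin 4)) :
    3 ^ w.length * (side r w).1 ∈ Subring.closure {zeta} := by
  induction w with
  | nil =>
    fin_cases r
    exacts [by simp [side, rootSide], by simp [side, rootSide], by simp [side, rootSide, zeta_mem]]
  | cons d w ih =>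
    have hu := unitDir_mem r w
    have h3 : (3 : ℂ) ∈ Subring.closure {zeta} := ofNat_mem _ 3
    have h : (3 : ℂ) ^ (d :: w).length * (side r (d :: w)).1 =
        3 * (3 ^ w.length * (side r w).1) + unitDir r w * ![0, 1, 2 - zeta, 2] d := by
      fin_cases d <;> simp [side, child, unitDir, conj_zeta] <;> ring
    rw [h]
    refine add_mem (mul_mem h3 ih) (mul_mem hu ?_)
    have h2 : (2 : ℂ) ∈ Subring.closure {zeta} := ofNat_mem _ 2
    fin_cases d
    exacts [zero_mem _, one_mem _, sub_mem h2 zeta_mem, h2]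

/-- This quantization of heights of Eisenstein integers feeds the parity argument in `hit_midpoint`.
-/
lemma height_of_mem_closure_zeta {z : ℂ} (hz : z ∈ Subring.closure {zeta}) :
    ∃ k : ℤ, height z = k / 2 := by
  obtain ⟨m, k, rfl⟩ := mem_closure_zeta hz
  refine ⟨k, ?_⟩
  have h₁ := height_ofReal_mul k zeta
  have h₂ := height_ofReal m
  push_cast at h₁ h₂
  rw [height_add, h₁, h₂, zeta_height]; ring

/-- A lattice line through the midpoint of a side which is not parallel to that side meets all sides
of the prefractal in their midpoints, and is not parallel to them. -/
lemma hit_midpoint {σ : ℂ} {r r' : Fin 3} {w w' : List (Fin 4)} (hw : w'.length = w.length)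
    {t τ : ℝ} (ht : t ∈ Icc (0 : ℝ) 1) (h : sideMid r w + τ * launch σ r w = chart r' w' t) :
    t = 1 / 2 ∧ height (unitDir r' w' * launch σ r w ^ 5) ≠ 0 := by
  set u := unitDir r w
  set u' := unitDir r' w' with hu'
  set v := launch σ r w with hv
  -- Multiplication by `v ^ 5`, the inverse of `v`, turns the trajectory horizontal. The starting
  -- side then has height difference -1/2, so its midpoint lies a quarter off the lattice heights.
  obtain ⟨hv6, hvc, hcv⟩ : v ^ 6 = 1 ∧
      v ∈ Subring.closure {zeta} ∧ height (u * v ^ 5) = -(1 / 2) := by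
    have hu6 : u ^ 6 = 1 := unitDir_pow_six r w
    have hz := zeta_pow_six
    rcases launch_eq_or σ r w with h | h
    · refine ⟨?_, ?_, ?_⟩
      · rw [hv, h, mul_pow, hu6, hz, mul_one]
      · rw [hv, h]; exact mul_mem zeta_mem (unitDir_mem r w)
      · have : u * v ^ 5 = 1 - zeta := by
          rw [hv, h, one_sub_zeta]; linear_combination zeta ^ 5 * hu6
        simp [this]
    · refine ⟨?_, ?_, ?_⟩
      · rw [hv, h, mul_pow, hu6, ← pow_mul, mul_comm 2, pow_mul, hz]; norm_num
      · rw [hv, h]; exact mul_mem (pow_mem zeta_mem 2) (unitDir_mem r w)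
      · have : u * v ^ 5 = -zeta := by
          rw [hv, h]
          linear_combination zeta ^ 10 * hu6 + zeta ^ 4 * hz + zeta * zeta_pow_three
        simp [this]
  have h5 : v ^ 5 ∈ Subring.closure {zeta} := pow_mem hvc 5
  obtain ⟨a, ha⟩ := height_of_mem_closure_zeta (mul_mem (side_mem r w) h5)
  obtain ⟨b, hb⟩ := height_of_mem_closure_zeta (mul_mem (side_mem r' w') h5)
  obtain ⟨k, hk⟩ := height_of_mem_closure_zeta (mul_mem (unitDir_mem r' w') h5)
  rw [← hu'] at hk
  have h3 : (3 : ℂ) ^ w.length * (1 / 3) ^ w.length = 1 := by rw [← mul_pow]; norm_num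
  -- The collision equation, scaled and rotated: the term in `τ` is real and disappears on taking
  -- heights.
  have e : (3 ^ w.length * (side r w).1) * v ^ 5 + (1 / 2 : ℝ) * (u * v ^ 5) +
      (3 ^ w.length * τ : ℝ) = (3 ^ w'.length * (side r' w').1) * v ^ 5 + (t : ℝ) * (u' * v ^ 5) := by
    rw [sideMid_eq, chart_eq, chart_eq] at h
    rw [hw] at h ⊢
    push_cast at h ⊢
    linear_combination (3 ^ w.length * v ^ 5) * h - 3 ^ w.length * τ * hv6 +
      (t * u' * v ^ 5 - 1 / 2 * u * v ^ 5) * h3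
  have e' := congrArg height e
  simp only [height_add, height_ofReal_mul, ha, hb, hk, hcv, height_ofReal] at e'
  have hk1 : |(k : ℝ)| < 2 := by
    have h₁ : (height (u' * v ^ 5)) ^ 2 * 3 ≤ 1 := by
      have h₂ : (u' * v ^ 5).im ^ 2 ≤ 1 := by
        have h₃ := Complex.abs_im_le_norm (u' * v ^ 5)
        rw [norm_mul, norm_pow, hu', norm_unitDir, hv, norm_launch] at h₃
        rw [← sq_abs]
        exact pow_le_one₀ (abs_nonneg _) (by simpa using h₃)
      rw [im_eq_height, mul_pow, Real.sq_sqrt (by norm_num)] at h₂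
      linarith
    rw [hk] at h₁
    exact abs_lt_of_sq_lt_sq (by nlinarith) (by norm_num)
  have hk2 : k = -1 ∨ k = 0 ∨ k = 1 := by
    rw [abs_lt] at hk1
    have h₁ : -2 < k := by exact_mod_cast hk1.1
    have h₂ : k < 2 := by exact_mod_cast hk1.2
    omega
  obtain ⟨ht0, ht1⟩ := ht
  rw [hk]
  -- The left side is an odd integer. This excludes `k = 0`, and for `k = ±1` it makes 2t an odd
  -- integer in [0, 2], so t = 1/2.
  have key : (2 : ℝ) * (a - b) - 1 = 2 * (t * k) := by linear_combination 4 * e'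
  rcases hk2 with rfl | rfl | rfl
  · push_cast at key ⊢
    refine ⟨?_, by norm_num⟩
    have h₁ : (2 : ℝ) * (a - b) ≤ 1 := by linarith
    have h₂ : (-1 : ℝ) ≤ 2 * (a - b) := by linarith
    have h₁ : 2 * (a - b) ≤ 1 := by exact_mod_cast h₁
    have h₂ : -1 ≤ 2 * (a - b) := by exact_mod_cast h₂
    have h₃ : a = b := by omega
    rw [h₃] at key; linarith
  · exfalso
    simp at key
    have h₁ : 2 * (a - b) = 1 := by
      have : (2 : ℝ) * (a - b) = 1 := by linarith
      exact_mod_cast this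
    omega
  · push_cast at key ⊢
    refine ⟨?_, by norm_num⟩
    have h₁ : (2 : ℝ) * (a - b) ≤ 3 := by linarith
    have h₂ : (1 : ℝ) ≤ 2 * (a - b) := by linarith
    have h₁ : 2 * (a - b) ≤ 3 := by exact_mod_cast h₁
    have h₂ : 1 ≤ 2 * (a - b) := by exact_mod_cast h₂
    have h₃ : a = b + 1 := by omega
    rw [h₃] at key; push_cast at key; linarith

lemma eq_of_pow_six_eq_one {c : ℂ} (hc : c ^ 6 = 1) : c = 1 ∨ c = -1 ∨ c = zeta ∨ c = zeta ^ 2 ∨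
    c = -zeta ∨ c = -zeta ^ 2 := by
  have h : (c - 1) * ((c + 1) * ((c - zeta) * ((c - zeta ^ 2) * ((c + zeta) * (c + zeta ^ 2))))) = 0 := by
    have e : (c - 1) * ((c + 1) * ((c - zeta) * ((c - zeta ^ 2) * ((c + zeta) * (c + zeta ^ 2))))) =
      (c ^ 2 - 1) * (c ^ 4 - (zeta ^ 2 + zeta ^ 4) * c ^ 2 + zeta ^ 6) := by ring
    rw [e, zeta_pow_six]
    linear_combination hc - (c ^ 2 - 1) * c ^ 2 * (zeta_sq + zeta * zeta_pow_three)
  simp only [mul_eq_zero] at h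
  rcases h with h | h | h | h | h | h
  · exact Or.inl (by linear_combination h)
  · exact Or.inr (Or.inl (by linear_combination h))
  · exact Or.inr (Or.inr (Or.inl (by linear_combination h)))
  · exact Or.inr (Or.inr (Or.inr (Or.inl (by linear_combination h))))
  · exact Or.inr (Or.inr (Or.inr (Or.inr (Or.inl (by linear_combination h)))))
  · exact Or.inr (Or.inr (Or.inr (Or.inr (Or.inr (by linear_combination h)))))

/-! ### The billiard map on midpoints -/

/-- The side chosen in `tangent` is the expected one because open sides of one level lie in disjoint
hulls. -/
lemma tangent_sideMid (r : Fin 3) (w : List (Fin 4)) :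
    tangent w.length (sideMid r w) = (side r w).2 - (side r w).1 := by
  have h : ∃ s : ℂ × ℂ, (∃ (r' : Fin 3) (w' : List (Fin 4)), w'.length = w.length ∧ s = side r' w') ∧
      sideMid r w ∈ openSegment ℝ s.1 s.2 := by
    refine ⟨_, ⟨r, w, rfl, rfl⟩, ?_⟩
    rw [openSegment_eq_image_segChart, sideMid_eq]
    exact ⟨1 / 2, by norm_num, rfl⟩
  rw [tangent, dif_pos h]
  obtain ⟨⟨r', w', hw, hs⟩, hm⟩ := h.choose_spec
  rw [hs] at hm ⊢
  rw [openSegment_eq_image_segChart] at hm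
  obtain ⟨t, ht, e⟩ := hm
  rw [sideMid_eq] at e
  obtain ⟨rfl, rfl⟩ := address_eq_of_hull hw (ofReal_mem_hull ht) half_mem_hull e
  rfl

lemma sideMid_injective {r r' : Fin 3} {w w' : List (Fin 4)} (hw : w.length = w'.length)
    (h : sideMid r w = sideMid r' w') : r = r' ∧ w = w' := by
  rw [sideMid_eq, sideMid_eq] at h
  exact address_eq_of_hull hw half_mem_hull half_mem_hull h

lemma sideMid_mem_KS (r : Fin 3) (w : List (Fin 4)) : sideMid r w ∈ KS w.length := by
  rw [sideMid_eq]; exact chart_mem_KS r w (by norm_num)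

/-- A trajectory from the midpoint of a side, launched with invariant `σ`, flies through the table to
the midpoint of another side, where it arrives at an angle of `±π/3` or `±2π/3`. -/
structure Flight (σ : ℂ) (r : Fin 3) (w : List (Fin 4)) (r' : Fin 3) (w' : List (Fin 4)) (τ : ℝ) :
    Prop where
  length_eq : w'.length = w.length
  pos : 0 < τ
  sideMid_eq : sideMid r' w' = sideMid r w + τ * launch σ r w
  interior : ∀ s ∈ Ioo 0 τ, sideMid r w + s * launch σ r w ∈ interior (table w.length)
  arrival : launch σ r w = -zeta ^ 2 * unitDir r' w' ∨ launch σ r w = -zeta * unitDir r' w'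

/-- Reflection sends v to u² times the conjugate of v. As u⁶ = 1 and σ is real, the cube is
conserved, and the reflected vector is an inward lattice direction. -/
lemma reflect_eq {r : Fin 3} {w : List (Fin 4)} {σ : ℂ} (hσ : σ ^ 2 = 1) {v : ℂ} (hv : v ^ 3 = σ)
    (h : v = -zeta ^ 2 * unitDir r w ∨ v = -zeta * unitDir r w) :
    reflect ((side r w).2 - (side r w).1) v = launch σ r w := by
  set u := unitDir r w with hu
  have hu0 : u ≠ 0 := unitDir_ne_zero r w
  have huu : u * (starRingEnd ℂ) u = 1 := by
    rw [Complex.mul_conj, Complex.normSq_eq_norm_sq, hu, norm_unitDir]; simp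
  have hcu : (starRingEnd ℂ) u = u⁻¹ := eq_inv_of_mul_eq_one_right huu
  have hq : ((side r w).2 - (side r w).1) / (starRingEnd ℂ) ((side r w).2 - (side r w).1) = u ^ 2 := by
    rw [side_sub, ← hu]
    simp only [map_mul, map_pow, map_div₀, map_one, map_ofNat, hcu]
    field_simp
  rw [reflect, hq]
  rcases h with rfl | rfl
  · have e : u ^ 2 * (starRingEnd ℂ) (-zeta ^ 2 * u) = zeta * u := by
      simp only [map_mul, map_neg, map_pow, conj_zeta, hcu]
      field_simp
      linear_combination -zeta_sq
    rw [e]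
    refine eq_launch hσ (Or.inl rfl) (Eq.trans ?_ hv)
    linear_combination (u ^ 3 * zeta ^ 3) * zeta_pow_three
  · have e : u ^ 2 * (starRingEnd ℂ) (-zeta * u) = zeta ^ 2 * u := by
      simp only [map_mul, map_neg, conj_zeta, hcu]
      field_simp
      linear_combination -zeta_sq
    rw [e]
    refine eq_launch hσ (Or.inr rfl) (Eq.trans ?_ hv)
    linear_combination (u ^ 3 * zeta ^ 3) * zeta_pow_three

lemma Flight.billiardMap_eq {σ : ℂ} (hσ : σ ^ 2 = 1) {r r' : Fin 3} {w w' : List (Fin 4)} {τ : ℝ}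
    (h : Flight σ r w r' w' τ) :
    billiardMap w.length (phase σ r w) = phase σ r' w' := by
  have ht : hitTime w.length (sideMid r w) (launch σ r w) = τ := by
    refine IsLeast.csInf_eq ⟨⟨h.pos, ?_⟩, fun s hs => ?_⟩
    · rw [← h.sideMid_eq, ← h.length_eq]; exact sideMid_mem_KS r' w'
    · by_contra! hlt
      exact notMem_interior_table_of_mem_KS hs.2 (h.interior s ⟨hs.1, hlt⟩)
  simp only [billiardMap, phase, ht, ← h.sideMid_eq]
  rw [← h.length_eq, tangent_sideMid, reflect_eq hσ (launch_pow_three hσ r w) h.arrival]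

lemma exists_flight {σ : ℂ} (r : Fin 3) (w : List (Fin 4)) :
    ∃ r' w' τ, Flight σ r w r' w' τ := by
  obtain ⟨τ, hτ, hK, hi⟩ := exists_first_hit r w (t := 1 / 2) (by norm_num)
    (height_localDir_launch_pos σ r w)
  rw [← sideMid_eq] at hK
  simp only [← sideMid_eq] at hi
  obtain ⟨r', w', hw, t, ht, e⟩ := mem_KS.1 hK
  obtain ⟨rfl, hnp⟩ := hit_midpoint hw ht e.symm
  rw [← sideMid_eq] at e
  refine ⟨r', w', τ, hw, hτ, e, hi, ?_⟩
  set u := unitDir r' w' with hu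
  set v := launch σ r w with hv
  have hu0 : u ≠ 0 := unitDir_ne_zero r' w'
  have hu6 : u ^ 6 = 1 := unitDir_pow_six r' w'
  have hv6 : v ^ 6 = 1 := by
    have h₁ := zeta_pow_six
    have h₂ := unitDir_pow_six r w
    rcases launch_eq_or σ r w with h | h <;> rw [hv, h, mul_pow, h₂]
    · rw [h₁, one_mul]
    · rw [← pow_mul, mul_comm 2, pow_mul, h₁]; norm_num
  obtain ⟨c, hc⟩ : ∃ c, v = c * u := ⟨v / u, by field_simp⟩
  have hc6 : c ^ 6 = 1 := by rwa [hc, mul_pow, hu6, mul_one] at hv6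
  -- Otherwise the trajectory would reach the side from outside: just before `τ` it would be in the
  -- hull of that side at negative height, off the table.
  have hout : ¬ 0 < height c := by
    intro hpos
    have h₁ : height (localDir r' w' (-v)) < 0 := by
      rw [localDir_neg, hc, localDir_mul_unitDir, height_neg, height_ofReal_mul]
      have : (0 : ℝ) < 3 ^ w'.length := by positivity
      nlinarith
    obtain ⟨ε, h₂, h₃, h₄⟩ := ((eventually_notMem_table r' w' (t := 1 / 2) (by norm_num) h₁).and
      (Ioo_mem_nhdsGT hτ)).exists
    apply h₂
    have h₅ := interior_subset (hi (τ - ε) ⟨by linarith, by linarith⟩)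
    rw [← sideMid_eq, e, hw]
    convert h₅ using 1
    push_cast; ring
  have hpar : height (u * v ^ 5) = height (c ^ 5) := by
    congr 1; rw [hc]; linear_combination c ^ 5 * hu6
  rw [hpar] at hnp
  rcases eq_of_pow_six_eq_one hc6 with rfl | rfl | rfl | rfl | rfl | rfl
  · simp at hnp
  · have : ((-1 : ℂ)) ^ 5 = -1 := by norm_num
    rw [this] at hnp; simp at hnp
  · simp at hout
  · simp at hout
  · exact Or.inr hc
  · exact Or.inl hc

/-! ### Lifting flights to the next table -/

open Classical in
/-- The child of a side hit last before leaving the cell in the launch direction. -/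
def lastHit (σ : ℂ) (r : Fin 3) (w : List (Fin 4)) : Fin 4 := if unitDir r w ^ 3 = σ then 2 else 1

open Classical in
/-- The child of a side hit first before leaving the cell in the launch direction. -/
def firstHit (σ : ℂ) (r : Fin 3) (w : List (Fin 4)) : Fin 4 := if unitDir r w ^ 3 = σ then 1 else 2

lemma unitDir_one (r : Fin 3) (w : List (Fin 4)) : unitDir r (1 :: w) = -zeta ^ 2 * unitDir r w := by
  rw [unitDir_cons]; change unitDir r w * (1 - zeta) = _; rw [zeta_sq]; ring

lemma unitDir_two (r : Fin 3) (w : List (Fin 4)) : unitDir r (2 :: w) = zeta * unitDir r w := by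
  rw [unitDir_cons]; change unitDir r w * zeta = _; ring

lemma unitDir_one_pow_three (r : Fin 3) (w : List (Fin 4)) :
    unitDir r (1 :: w) ^ 3 = -unitDir r w ^ 3 := by
  rw [unitDir_one]
  linear_combination -(unitDir r w ^ 3) * zeta_pow_six

lemma unitDir_two_pow_three (r : Fin 3) (w : List (Fin 4)) :
    unitDir r (2 :: w) ^ 3 = -unitDir r w ^ 3 := by
  rw [unitDir_two]
  linear_combination (unitDir r w ^ 3) * zeta_pow_three

lemma lastHit_eq_or (σ : ℂ) (r : Fin 3) (w : List (Fin 4)) :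
    lastHit σ r w = 1 ∧ firstHit σ r w = 2 ∨ lastHit σ r w = 2 ∧ firstHit σ r w = 1 := by
  unfold lastHit firstHit; split_ifs <;> simp

lemma launch_child {σ : ℂ} (hσ : σ ^ 2 = 1) (r : Fin 3) (w : List (Fin 4)) :
    launch σ r (lastHit σ r w :: w) = launch σ r w := by
  rcases unitDir_pow_three r w hσ with h | h
  · rw [lastHit, if_pos h, launch_of_pos h, launch_of_neg hσ (by rw [unitDir_two_pow_three, h]),
      unitDir_two]; ring
  · rw [lastHit, if_neg (h ▸ ne_neg_of_sq hσ), launch_of_neg hσ h,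
      launch_of_pos (by rw [unitDir_one_pow_three, h, neg_neg]), unitDir_one]
    linear_combination -zeta * unitDir r w * zeta_pow_three

lemma childChart_one_half : childChart 1 (1 / 2 : ℝ) = (1 / 2 : ℝ) - (1 / 6 : ℝ) * zeta := by
  rw [childChart_one]; push_cast; ring

lemma childChart_two_half : childChart 2 (1 / 2 : ℝ) = (1 / 2 : ℝ) - (1 / 6 : ℝ) * zeta ^ 2 := by
  rw [childChart_two, zeta_sq]; push_cast; ring

lemma sideMid_one (r : Fin 3) (w : List (Fin 4)) :
    sideMid r (1 :: w) = sideMid r w - ((1 / 3) ^ w.length / 6 : ℝ) * (zeta * unitDir r w) := by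
  rw [sideMid_eq, chart_cons, childChart_one_half, sideMid_eq, chart_eq, chart_eq]
  push_cast; ring

lemma sideMid_two (r : Fin 3) (w : List (Fin 4)) :
    sideMid r (2 :: w) = sideMid r w - ((1 / 3) ^ w.length / 6 : ℝ) * (zeta ^ 2 * unitDir r w) := by
  rw [sideMid_eq, chart_cons, childChart_two_half, sideMid_eq, chart_eq, chart_eq]
  push_cast; ring

/-- Together with `launch_child`: the launch from this child runs along the parent's launch line,
starting slightly further back. -/
lemma sideMid_lastHit {σ : ℂ} (hσ : σ ^ 2 = 1) (r : Fin 3) (w : List (Fin 4)) :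
    sideMid r (lastHit σ r w :: w) =
      sideMid r w - ((1 / 3) ^ w.length / 6 : ℝ) * launch σ r w := by
  rcases unitDir_pow_three r w hσ with h | h
  · rw [lastHit, if_pos h, launch_of_pos h, sideMid_two]
  · rw [lastHit, if_neg (h ▸ ne_neg_of_sq hσ), launch_of_neg hσ h, sideMid_one]

lemma sub_zeta_mem_passage {ρ : ℝ} (h₀ : 0 ≤ ρ) (h₁ : ρ < 1 / 6) :
    (1 / 2 : ℝ) - ρ * zeta ∈ passage ∧ (1 / 2 : ℝ) - ρ * zeta ^ 2 ∈ passage := by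
  have hr : ((1 / 2 : ℝ) - ρ * zeta : ℂ).re = 1 / 2 - ρ / 2 := by
    simp [re_mul, -Complex.mul_re]; ring
  have hr' : ((1 / 2 : ℝ) - ρ * zeta ^ 2 : ℂ).re = 1 / 2 + ρ / 2 := by
    simp only [Complex.sub_re, re_mul, Complex.ofReal_re, height_ofReal, zeta_sq_re]; ring
  have hh : height ((1 / 2 : ℝ) - ρ * zeta : ℂ) = -(ρ / 2) := by
    rw [height_sub, height_ofReal, height_ofReal_mul, zeta_height]; ring
  have hh' : height ((1 / 2 : ℝ) - ρ * zeta ^ 2 : ℂ) = -(ρ / 2) := by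
    rw [height_sub, height_ofReal, height_ofReal_mul, zeta_sq_height]; ring
  constructor <;> refine ⟨?_, ?_, ?_, ?_⟩ <;> simp only [hr, hr', hh, hh'] <;> linarith

/-- The flight between the two sides of a cell. -/
lemma flight_cell {σ : ℂ} (hσ : σ ^ 2 = 1) (r : Fin 3) (w : List (Fin 4)) :
    Flight σ r (firstHit σ r w :: w) r (lastHit σ r w :: w) ((1 / 3) ^ w.length / 6) := by
  have hpos : (0 : ℝ) < (1 / 3) ^ w.length / 6 := by positivity
  have h3 : (3 : ℝ) ^ w.length * (1 / 3) ^ w.length = 1 := by rw [← mul_pow]; norm_num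
  have h3' : (0 : ℝ) < 3 ^ w.length := by positivity
  rcases unitDir_pow_three r w hσ with h | h
  -- From a cell side the launch is parallel to the base, along the segment joining the midpoints of
  -- the two cell sides.
  · have hl : launch σ r (1 :: w) = 1 * unitDir r w := by
      rw [launch_of_neg hσ (by rw [unitDir_one_pow_three, h]), unitDir_one]
      linear_combination -unitDir r w * zeta_pow_three
    rw [firstHit, lastHit, if_pos h, if_pos h]
    refine ⟨rfl, hpos, ?_, fun s hs => ?_, ?_⟩
    · rw [hl, sideMid_one, sideMid_two, zeta_sq]; ring
    · have hs' : s * 3 ^ w.length < 1 / 6 := by have := hs.2; nlinarith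
      have hs'' : 0 < s * 3 ^ w.length := mul_pos hs.1 h3'
      have e : sideMid r (1 :: w) + s * launch σ r (1 :: w) = chart r w
          ((1 / 2 : ℝ) + (s * 3 ^ w.length : ℝ) - (1 / 6 : ℝ) * zeta) := by
        rw [hl, sideMid_eq, chart_cons, childChart_one_half, chart_add, localDir_ofReal_mul,
          localDir_mul_unitDir]
        push_cast; ring_nf
      rw [e]
      refine chart_passage_mem_interior r w ?_
      have hr : ((1 / 2 : ℝ) + (s * 3 ^ w.length : ℝ) - (1 / 6 : ℝ) * zeta : ℂ).re =
          5 / 12 + s * 3 ^ w.length := by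
        simp only [Complex.sub_re, Complex.add_re, re_mul, Complex.ofReal_re, height_ofReal, zeta_re]
        ring
      have hh : height ((1 / 2 : ℝ) + (s * 3 ^ w.length : ℝ) - (1 / 6 : ℝ) * zeta : ℂ) = -(1 / 12) := by
        simp only [height_sub, height_add, height_ofReal, height_ofReal_mul, zeta_height]; norm_num
      refine ⟨?_, ?_, ?_, ?_⟩ <;> rw [hr, hh] <;> linarith
    · left; rw [hl, unitDir_two]; linear_combination unitDir r w * zeta_pow_three
  · have hl : launch σ r (2 :: w) = (-1) * unitDir r w := by
      rw [launch_of_pos (by rw [unitDir_two_pow_three, h, neg_neg]), unitDir_two]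
      linear_combination unitDir r w * zeta_pow_three
    rw [firstHit, lastHit, if_neg (h ▸ ne_neg_of_sq hσ), if_neg (h ▸ ne_neg_of_sq hσ)]
    refine ⟨rfl, hpos, ?_, fun s hs => ?_, ?_⟩
    · rw [hl, sideMid_one, sideMid_two, zeta_sq]; ring
    · have hs' : s * 3 ^ w.length < 1 / 6 := by have := hs.2; nlinarith
      have hs'' : 0 < s * 3 ^ w.length := mul_pos hs.1 h3'
      have e : sideMid r (2 :: w) + s * launch σ r (2 :: w) = chart r w
          ((1 / 2 : ℝ) - (s * 3 ^ w.length : ℝ) - (1 / 6 : ℝ) * zeta ^ 2) := by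
        rw [hl, sideMid_eq, chart_cons, childChart_two_half, chart_add, localDir_ofReal_mul,
          localDir_mul_unitDir]
        push_cast; ring_nf
      rw [e]
      refine chart_passage_mem_interior r w ?_
      have hr : ((1 / 2 : ℝ) - (s * 3 ^ w.length : ℝ) - (1 / 6 : ℝ) * zeta ^ 2 : ℂ).re =
          7 / 12 - s * 3 ^ w.length := by
        simp only [Complex.sub_re, re_mul, Complex.ofReal_re, height_ofReal, zeta_sq_re]
        ring
      have hh : height ((1 / 2 : ℝ) - (s * 3 ^ w.length : ℝ) - (1 / 6 : ℝ) * zeta ^ 2 : ℂ) =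
          -(1 / 12) := by
        simp only [height_sub, height_ofReal, height_ofReal_mul, zeta_sq_height]; norm_num
      refine ⟨?_, ?_, ?_, ?_⟩ <;> rw [hr, hh] <;> linarith
    · right; rw [hl, unitDir_one]; linear_combination -unitDir r w * zeta_pow_three

lemma sideMid_add_mem_interior {r : Fin 3} {w : List (Fin 4)} {c : ℂ}
    (hc : c = zeta ∨ c = zeta ^ 2) {s : ℝ} (h₀ : 0 ≤ s) (h₁ : s < (1 / 3) ^ w.length / 6) :
    sideMid r w - s * (c * unitDir r w) ∈ interior (table (w.length + 1)) := by
  have h3 : (3 : ℝ) ^ w.length * (1 / 3) ^ w.length = 1 := by rw [← mul_pow]; norm_num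
  have h3' : (0 : ℝ) < 3 ^ w.length := by positivity
  have h := sub_zeta_mem_passage (ρ := s * 3 ^ w.length) (by positivity) (by nlinarith)
  have e : sideMid r w - s * (c * unitDir r w) =
      chart r w ((1 / 2 : ℝ) - (s * 3 ^ w.length : ℝ) * c) := by
    have := sideMid_add r w (-s) c
    push_cast at this ⊢
    rw [sub_eq_add_neg, ← neg_mul, this, sub_eq_add_neg, neg_mul, neg_mul]
  rw [e]
  refine chart_passage_mem_interior r w ?_
  rcases hc with rfl | rfl
  exacts [h.1, h.2]

/-- The line of flight, prolonged by a sixth of a side length at both ends, joins midpoints of cell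
sides. The prolongations run through the opened middle thirds. -/
lemma Flight.lift {σ : ℂ} (hσ : σ ^ 2 = 1) {r r' : Fin 3} {w w' : List (Fin 4)} {τ : ℝ}
    (h : Flight σ r w r' w' τ) :
    Flight σ r (lastHit σ r w :: w) r' (firstHit σ r' w' :: w')
      (τ + 2 * ((1 / 3) ^ w.length / 6)) := by
  set κ : ℝ := (1 / 3) ^ w.length / 6 with hκ
  have hκ0 : 0 < κ := by positivity
  have hτ := h.pos
  set v := launch σ r w with hv
  have hl := launch_child hσ r w
  have hm := sideMid_lastHit hσ r w
  rw [← hv] at hl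
  rw [← hv, ← hκ] at hm
  have hlen := h.length_eq
  have hv3 : v ^ 3 = σ := launch_pow_three hσ r w
  -- `c` is the reversed arrival direction relative to the side that is hit; it decides which cell
  -- side lies straight ahead.
  obtain ⟨c, hc, hvc, hm', harr⟩ : ∃ c, (c = zeta ∨ c = zeta ^ 2) ∧ v = -(c * unitDir r' w') ∧
      sideMid r' (firstHit σ r' w' :: w') = sideMid r' w' + κ * v ∧
      (v = -zeta ^ 2 * unitDir r' (firstHit σ r' w' :: w') ∨
        v = -zeta * unitDir r' (firstHit σ r' w' :: w')) := by
    rcases h.arrival with ha | ha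
    · refine ⟨zeta ^ 2, Or.inr rfl, by rw [← neg_mul]; exact ha, ?_⟩
      have h3 : unitDir r' w' ^ 3 = -σ := by
        rw [← hv3, hv, ha]
        linear_combination -(unitDir r' w' ^ 3) * zeta_pow_six
      rw [firstHit, if_neg (h3 ▸ ne_neg_of_sq hσ)]
      refine ⟨by rw [hv, ha, sideMid_two, hlen, hκ]; ring, Or.inr ?_⟩
      rw [hv, ha, unitDir_two]; ring
    · refine ⟨zeta, Or.inl rfl, by rw [← neg_mul]; exact ha, ?_⟩
      have h3 : unitDir r' w' ^ 3 = σ := by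
        rw [← hv3, hv, ha]
        linear_combination (unitDir r' w' ^ 3) * zeta_pow_three
      rw [firstHit, if_pos h3]
      refine ⟨by rw [hv, ha, sideMid_one, hlen, hκ]; ring, Or.inl ?_⟩
      rw [hv, ha, unitDir_one]
      linear_combination -zeta * unitDir r' w' * zeta_pow_three
  refine ⟨by simp [hlen], by positivity, ?_, fun s hs => ?_, by rwa [hl]⟩
  · rw [hl, hm, hm', h.sideMid_eq]; push_cast; ring
  · rw [hl, hm, List.length_cons]
    have e₁ : sideMid r w - κ * v + s * v = sideMid r w + (s - κ : ℝ) * v := by push_cast; ring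
    rw [e₁]
    obtain ⟨hs₀, hs₁⟩ := hs
    -- Three stretches: out of the cell at departure, the old flight, into the cell at arrival.
    rcases le_or_gt s κ with h₁ | h₁
    · have e₂ : sideMid r w + (s - κ : ℝ) * v = sideMid r w - (κ - s : ℝ) * v := by push_cast; ring
      rw [e₂]
      rcases launch_eq_or σ r w with hv' | hv' <;> rw [hv, hv']
      · exact sideMid_add_mem_interior (Or.inl rfl) (by linarith) (by rw [← hκ]; linarith)
      · exact sideMid_add_mem_interior (Or.inr rfl) (by linarith) (by rw [← hκ]; linarith)
    rcases lt_or_ge s (κ + τ) with h₂ | h₂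
    · exact interior_mono (table_subset_succ _) (h.interior (s - κ) ⟨by linarith, by linarith⟩)
    · have e₂ : sideMid r w + (s - κ : ℝ) * v =
          sideMid r' w' - (s - κ - τ : ℝ) * (c * unitDir r' w') := by
        rw [h.sideMid_eq]
        push_cast
        linear_combination ((s : ℂ) - κ - τ) * hvc
      rw [e₂, ← hlen]
      refine sideMid_add_mem_interior hc (by linarith) ?_
      rw [hlen, ← hκ]; linarith

/-! ### Initial conditions of compatible sequences -/

lemma ofReal_mem_inner {t : ℝ} (ht : t ∈ Icc (0 : ℝ) 1) : (t : ℂ) ∈ inner := by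
  obtain ⟨h₁, h₂⟩ := ht
  refine ⟨?_, ?_, ?_⟩ <;> simp <;> linarith

lemma KS_subset_table (n : ℕ) : KS n ⊆ table n := by
  intro z hz
  obtain ⟨r, w, rfl, t, ht, rfl⟩ := mem_KS.1 hz
  exact chart_inner_mem_table r w (ofReal_mem_inner ht)

lemma sbtw_add_mul {x θ : ℂ} (hθ : θ ≠ 0) {s t : ℝ} (h : 0 < s ∧ s < t ∨ t < s ∧ s < 0) :
    Sbtw ℝ x (x + s * θ) (x + t * θ) := by
  have ht : t ≠ 0 := by rintro rfl; rcases h with h | h <;> linarith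
  have hs : s ≠ 0 := by rintro rfl; rcases h with h | h <;> linarith
  have hst : s ≠ t := by rintro rfl; rcases h with h | h <;> linarith
  refine ⟨⟨s / t, ?_, ?_⟩, by simpa using ⟨hs, hθ⟩, by simpa using ⟨hst, hθ⟩⟩
  · rcases h with h | h
    · exact ⟨div_nonneg h.1.le (h.1.trans h.2).le, div_le_one_of_le₀ h.2.le (h.1.trans h.2).le⟩
    · exact ⟨div_nonneg_of_nonpos h.2.le (h.1.trans h.2).le,
        div_le_one_of_ge h.1.le (h.1.trans h.2).le⟩
  · have : (t : ℂ) ≠ 0 := by exact_mod_cast ht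
    simp [AffineMap.lineMap_apply]
    field_simp
    ring

section CompatibleSeq

variable {x : ℕ → ℂ} {θ : ℂ}

lemma IsInward.mem_KS {n : ℕ} {y : ℂ} (h : IsInward n y θ) : y ∈ KS n := by
  obtain ⟨r, w, rfl, t, ht, rfl, _⟩ := isInward_iff.1 h
  exact chart_mem_KS r w ⟨ht.1.le, ht.2.le⟩

lemma IsInward.eventually_add {n : ℕ} {y : ℂ} (h : IsInward n y θ) :
    ∀ᶠ ε : ℝ in 𝓝[>] 0, y + ε * θ ∈ table n := by
  obtain ⟨r, w, rfl, t, ht, rfl, hv⟩ := isInward_iff.1 h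
  exact (eventually_mem_interior_table r w ht hv).mono fun _ h => interior_subset h

lemma IsInward.eventually_sub {n : ℕ} {y : ℂ} (h : IsInward n y θ) :
    ∀ᶠ ε : ℝ in 𝓝[>] 0, y - ε * θ ∉ table n := by
  obtain ⟨r, w, rfl, t, ht, rfl, hv⟩ := isInward_iff.1 h
  have := eventually_notMem_table r w ht (v := -θ) (by rw [localDir_neg, height_neg]; linarith)
  simpa [sub_eq_add_neg] using this

lemma IsCompatibleSeq.ne_zero (h : IsCompatibleSeq x θ) : θ ≠ 0 := by
  rintro rfl; simpa using h.norm_eq_one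

/-- The initial points recede backwards from `x 0`. If `x n` lay ahead, the unobstructed segment
from `x 0` would keep inside the table up to `x n`, whereas points just behind `x n` are outside,
`θ` being inward there. -/
lemma IsCompatibleSeq.exists_times (h : IsCompatibleSeq x θ) :
    ∃ t : ℕ → ℝ, (∀ n, x n = x 0 + t n * θ) ∧ (∀ n, t n ≤ 0) ∧
      ∀ n s, t n < s → s < 0 → x 0 + s * θ ∈ interior (table n) := by
  choose t ht using h.collinear
  have hle : ∀ n, t n ≤ 0 := by
    intro n
    by_contra! hpos
    obtain ⟨ε, h₁, h₂, h₃⟩ := ((h.inward n).eventually_sub.and (Ioo_mem_nhdsGT hpos)).exists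
    obtain ⟨δ, h₁', h₂', h₃'⟩ := ((h.inward 0).eventually_add.and (Ioo_mem_nhdsGT hpos)).exists
    have := mem_interior_of_forall_notMem (n := n) (x := x 0) (v := θ) (a := 0) (b := t n)
      (fun s hs => h.visible n _ (by rw [ht n]; exact sbtw_add_mul h.ne_zero (Or.inl hs)))
      ⟨h₂', h₃'⟩ (table_mono (Nat.zero_le n) h₁') (t := t n - ε) ⟨by linarith, by linarith⟩
    apply h₁
    convert interior_subset this using 1
    rw [ht n]; push_cast; ring
  refine ⟨t, ht, hle, fun n s h₀ h₁ => ?_⟩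
  obtain ⟨ε, h₂, h₃, h₄⟩ := ((h.inward n).eventually_add.and
    (Ioo_mem_nhdsGT (show (0 : ℝ) < -t n by linarith))).exists
  refine mem_interior_of_forall_notMem (n := n) (x := x 0) (v := θ) (a := t n) (b := 0)
    (fun s hs => h.visible n _ (by rw [ht n]; exact sbtw_add_mul h.ne_zero (Or.inr hs)))
    (t₀ := t n + ε) ⟨by linarith, by linarith⟩ ?_ ⟨h₀, h₁⟩
  convert h₂ using 1
  rw [ht n]; push_cast; ring

lemma IsCompatibleSeq.exists_backward (h : IsCompatibleSeq x θ) {n : ℕ} (hne : x (n + 1) ≠ x n) :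
    ∃ τ : ℝ, 0 < τ ∧ x n = x (n + 1) + τ * θ ∧
      ∀ s ∈ Ioo 0 τ, x n - s * θ ∈ interior (table (n + 1)) := by
  obtain ⟨t, ht, hle, hi⟩ := h.exists_times
  have hlt : t (n + 1) < t n := by
    have hn : t (n + 1) ≠ t n := fun e => hne (by rw [ht, ht n, e])
    -- Were `x (n + 1)` ahead of `x n`, it would lie in the interior of the old table, or, when its
    -- time is 0, have points of the old table just behind it.
    refine hn.lt_or_gt.resolve_right fun hgt => ?_
    rcases (hle (n + 1)).lt_or_eq with h₁ | h₁
    · refine notMem_interior_table_of_mem_KS_succ (h.inward (n + 1)).mem_KS ?_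
      rw [ht]; exact hi n _ hgt h₁
    · rw [h₁] at hgt
      obtain ⟨ε, h₂, h₃, h₄⟩ := ((h.inward (n + 1)).eventually_sub.and
        (Ioo_mem_nhdsGT (show (0 : ℝ) < -t n by linarith))).exists
      apply h₂
      have h₅ := table_subset_succ n (interior_subset (hi n (-ε) (by linarith) (by linarith)))
      convert h₅ using 1
      rw [ht (n + 1), h₁]; push_cast; ring
  refine ⟨t n - t (n + 1), by linarith, by rw [ht, ht (n + 1)]; push_cast; ring, fun s hs => ?_⟩
  have h₁ := hi (n + 1) (t n - s) (by linarith [hs.2]) (by linarith [hs.1, hle n])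
  convert h₁ using 1
  rw [ht n]; push_cast; ring

/-- The backward trajectory stays in the cell of the next level until it hits the curve. -/
lemma mem_cell_of_backward {r : Fin 3} {w : List (Fin 4)} {ξ τ : ℝ} (hξ : ξ ∈ Ioo (0 : ℝ) 1)
    (hθ : 0 < height (localDir r w θ)) (hτ : 0 < τ)
    (hi : ∀ s ∈ Ioo 0 τ, chart r w ξ - s * θ ∈ interior (table (w.length + 1))) :
    ∃ y ∈ cell, height y < 0 ∧ chart r w y = chart r w ξ - τ * θ := by
  set η := localDir r w θ with hη
  have hch : ∀ s : ℝ, chart r w ξ - s * θ = chart r w (ξ - s * η) := by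
    intro s
    rw [hη, sub_eq_add_neg, ← neg_mul, ← Complex.ofReal_neg, chart_add, localDir_ofReal_mul]
    push_cast; ring_nf
  have hht : ∀ s : ℝ, height (ξ - s * η) = -(s * height η) := by
    intro s; simp
  simp only [hch] at hi ⊢
  obtain ⟨ε, h₁, h₂, h₃⟩ := ((eventually_mem_hull hξ (v := -η) (by simpa using hθ)).and
    (Ioo_mem_nhdsGT hτ)).exists
  have hstart : (ξ - ε * η : ℂ) ∈ cell := by
    have e : (ξ + ε * -η : ℂ) = ξ - ε * η := by ring
    rw [e] at h₁
    exact mem_cell_of_chart_mem_table h₁.1 h₁.2 (interior_subset (hi ε ⟨h₂, h₃⟩))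
  have hall : ∀ s ∈ Ioo 0 τ, (ξ - s * η : ℂ) ∈ cell := by
    intro s hs
    have hc : IsPreconnected ((fun s : ℝ => (ξ - s * η : ℂ)) '' Ioo 0 τ) :=
      isPreconnected_Ioo.image _ (by fun_prop)
    -- The path meets neither the base (its height is negative) nor the new sides (it is interior to
    -- the new table), so it cannot cross the boundary of the cell.
    have hint : ∀ s ∈ Ioo 0 τ, (ξ - s * η : ℂ) ∈ cell → (ξ - s * η : ℂ) ∈ interior cell := by
      intro s hs hm
      rcases mem_passage_or_of_mem_cell hm with ⟨p₁, p₂, _⟩ | ⟨d, t, ht, e⟩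
      · have ho : IsOpen {z : ℂ | height z < 0 ∧ -height z < z.re - 1 / 3 ∧
            -height z < 2 / 3 - z.re} := by
          refine IsOpen.and (isOpen_lt ?_ ?_) (IsOpen.and (isOpen_lt ?_ ?_)
            (isOpen_lt ?_ ?_)) <;> fun_prop
        refine mem_interior.2 ⟨_, fun y hy => ⟨hy.1.le, hy.2.1.le, hy.2.2.le⟩, ho, ?_, p₁, p₂⟩
        rw [hht]; linarith [mul_pos hs.1 hθ]
      · exact absurd (hi s hs) (e ▸ notMem_interior_table_of_mem_KS
          (chart_childChart_mem_KS r w d ht))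
    refine interior_subset (hc.subset_left_of_subset_union (v := cellᶜ) isOpen_interior
      isCompact_cell.isClosed.isOpen_compl ?_ ?_ ?_ (mem_image_of_mem _ hs))
    · exact disjoint_left.2 fun z h₁ h₂ => h₂ (interior_subset h₁)
    · rintro _ ⟨s, hs, rfl⟩
      by_cases hm : (ξ - s * η : ℂ) ∈ cell
      exacts [Or.inl (hint s hs hm), Or.inr hm]
    · exact ⟨_, mem_image_of_mem _ ⟨h₂, h₃⟩, hint ε ⟨h₂, h₃⟩ hstart⟩
  refine ⟨ξ - τ * η, ?_, by rw [hht]; linarith [mul_pos hτ hθ], rfl⟩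
  have hcl : IsClosed ((fun s : ℝ => (ξ - s * η : ℂ)) ⁻¹' cell) :=
    isCompact_cell.isClosed.preimage (by fun_prop)
  have := hcl.closure_subset_iff.2 (show Ioo 0 τ ⊆ _ from hall)
  rw [closure_Ioo hτ.ne] at this
  exact this (right_mem_Icc.2 hτ.le)

lemma childChart_half_mem_hull (d : Fin 4) : childChart d (1 / 2 : ℝ) ∈ hull :=
  childChart_mem_hull d half_mem_hull

lemma IsCellSideMidpoint.notMem_table {n : ℕ} {z : ℂ} (h : IsCellSideMidpoint (n + 1) z) :
    z ∉ table n := by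
  obtain ⟨r, w, d, hw, hd, rfl⟩ := h
  obtain rfl : w.length = n := by simpa using hw
  rw [sideMid_eq, chart_cons]
  refine chart_notMem_table r w (childChart_half_mem_hull d) ?_
  rw [childChart_height]
  rcases hd with rfl | rfl
  · simp only [height_ofReal, Complex.ofReal_re]; simp; norm_num
  · simp only [height_ofReal, Complex.ofReal_re]; simp; norm_num

/-- The initial side of the next orbit is a child of the initial side, hit in the backward direction. -/
lemma IsCompatibleSeq.exists_child (h : IsCompatibleSeq x θ) {n : ℕ}
    (hc : IsCellSideMidpoint (n + 1) (x (n + 1))) :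
    ∃ (r : Fin 3) (w : List (Fin 4)) (ξ τ : ℝ) (d : Fin 4), w.length = n ∧ ξ ∈ Ioo (0 : ℝ) 1 ∧
      x n = chart r w ξ ∧ 0 < height (localDir r w θ) ∧ (d = 1 ∨ d = 2) ∧
      x (n + 1) = sideMid r (d :: w) ∧ 0 < τ ∧ x n = x (n + 1) + τ * θ := by
  have hne : x (n + 1) ≠ x n := fun e =>
    hc.notMem_table (e ▸ KS_subset_table n (h.inward n).mem_KS)
  obtain ⟨τ, hτ, e, hi⟩ := h.exists_backward hne
  obtain ⟨r, w, hw, ξ, hξ, hx, hθ⟩ := isInward_iff.1 (h.inward n)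
  rw [← hx, ← hw] at hi
  obtain ⟨y, hy, -, hy'⟩ := mem_cell_of_backward hξ hθ hτ hi
  obtain ⟨r', w', d, hw', hd, hm⟩ := hc
  have hy'' : chart r w y = chart r' w' (childChart d (1 / 2 : ℝ)) := by
    rw [← chart_cons, ← sideMid_eq, ← hm, hy', hx, e]; ring
  obtain ⟨rfl, rfl⟩ := address_eq_of_hull (by omega) (cell_subset_hull hy)
    (childChart_half_mem_hull d) hy''
  exact ⟨r, w, ξ, τ, d, hw, hξ, hx.symm, hθ, hd, hm, hτ, e⟩

lemma eq_of_ofReal_mul_eq {a b : ℝ} (ha : 0 < a) (hb : 0 < b) {u v : ℂ} (hu : ‖u‖ = 1)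
    (hv : ‖v‖ = 1) (h : (a : ℂ) * u = b * v) : u = v := by
  have h₁ := congrArg norm h
  rw [norm_mul, norm_mul, hu, hv, Complex.norm_real, Complex.norm_real, Real.norm_of_nonneg ha.le,
    Real.norm_of_nonneg hb.le, mul_one, mul_one] at h₁
  subst h₁
  exact mul_left_cancel₀ (by exact_mod_cast ha.ne') h

/-- At a side whose midpoint belongs to the sequence, the direction is one of the two inward lattice
directions. -/
lemma direction_of_child (hθ : ‖θ‖ = 1) {r : Fin 3} {w : List (Fin 4)} {d : Fin 4} {τ : ℝ}
    (hτ : 0 < τ) (hd : d = 1 ∨ d = 2) (h : sideMid r w = sideMid r (d :: w) + τ * θ) :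
    d = 1 ∧ θ = zeta * unitDir r w ∨ d = 2 ∧ θ = zeta ^ 2 * unitDir r w := by
  have hκ : (0 : ℝ) < (1 / 3) ^ w.length / 6 := by positivity
  rcases hd with rfl | rfl
  · refine Or.inl ⟨rfl, eq_of_ofReal_mul_eq hτ hκ hθ (by simp [norm_zeta, norm_unitDir]) ?_⟩
    rw [sideMid_one] at h
    linear_combination -h
  · refine Or.inr ⟨rfl, eq_of_ofReal_mul_eq hτ hκ hθ (by simp [norm_zeta, norm_unitDir]) ?_⟩
    rw [sideMid_two] at h
    linear_combination -h

lemma IsCompatibleSeq.exists_child_of_midpoint (h : IsCompatibleSeq x θ) {n : ℕ}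
    (hn : IsCellSideMidpoint n (x n)) (hc : IsCellSideMidpoint (n + 1) (x (n + 1))) :
    ∃ (r : Fin 3) (w : List (Fin 4)) (d : Fin 4), w.length = n ∧ x n = sideMid r w ∧
      x (n + 1) = sideMid r (d :: w) ∧
      (d = 1 ∧ θ = zeta * unitDir r w ∨ d = 2 ∧ θ = zeta ^ 2 * unitDir r w) := by
  obtain ⟨r, w, ξ, τ, d, hw, hξ, hx, hin, hd, hx', hτ, e⟩ := h.exists_child hc
  obtain ⟨r', w', d', hw', -, hm⟩ := hn
  have hm' := hm
  rw [hx, sideMid_eq] at hm'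
  obtain ⟨rfl, rfl⟩ := address_eq_of_hull (by rw [hw, List.length_cons, hw']) (ofReal_mem_hull hξ)
    half_mem_hull hm'
  refine ⟨r, _, d, hw, hm, hx', direction_of_child h.norm_eq_one hτ hd ?_⟩
  rw [← hm, ← hx', e]

/-- One level before the sequence becomes piecewise Fagnano, the initial point is already the midpoint
of a side. -/
lemma IsCompatibleSeq.exists_child_of_midpoint_succ (h : IsCompatibleSeq x θ) {n : ℕ}
    (hn : IsCellSideMidpoint (n + 1) (x (n + 1)))
    (hc : IsCellSideMidpoint (n + 2) (x (n + 2))) :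
    ∃ (r : Fin 3) (w : List (Fin 4)) (d : Fin 4), w.length = n ∧ x n = sideMid r w ∧
      x (n + 1) = sideMid r (d :: w) ∧
      (d = 1 ∧ θ = zeta * unitDir r w ∨ d = 2 ∧ θ = zeta ^ 2 * unitDir r w) := by
  obtain ⟨r, w, ξ, τ, d, hw, hξ, hx, hin, hd, hx', hτ, e⟩ := h.exists_child hn
  obtain ⟨r', w', _, hw', hm, -, hθ⟩ := h.exists_child_of_midpoint hn hc
  obtain ⟨rfl, rfl⟩ := sideMid_injective (by simp [hw, hw']) (hx'.symm.trans hm)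
  have h3' : (0 : ℝ) < 3 ^ w.length := by positivity
  -- The next level leaves two directions at the child side. One is parallel to the parent side,
  -- hence not inward there; the other is the parent's lattice direction.
  have hθ' : d = 1 ∧ θ = zeta * unitDir r w ∨ d = 2 ∧ θ = zeta ^ 2 * unitDir r w := by
    rcases hd with rfl | rfl
    · refine Or.inl ⟨rfl, ?_⟩
      rw [unitDir_one] at hθ
      rcases hθ with ⟨-, hθ⟩ | ⟨-, hθ⟩
      · exfalso
        have : θ = 1 * unitDir r w := by
          rw [hθ]; linear_combination -unitDir r w * zeta_pow_three
        rw [this, localDir_mul_unitDir, height_ofReal_mul] at hin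
        simp at hin
      · rw [hθ]; linear_combination -zeta * unitDir r w * zeta_pow_three
    · refine Or.inr ⟨rfl, ?_⟩
      rw [unitDir_two] at hθ
      rcases hθ with ⟨-, hθ⟩ | ⟨-, hθ⟩
      · rw [hθ]; ring
      · exfalso
        have : θ = (-1) * unitDir r w := by
          rw [hθ]; linear_combination unitDir r w * zeta_pow_three
        rw [this, localDir_mul_unitDir, height_ofReal_mul] at hin
        simp at hin
  refine ⟨r, w, d, hw, ?_, hx', hθ'⟩
  rw [hx', hx] at e
  -- In coordinates of the side the child midpoint is 1/2 - c/6, with `c` the launch direction.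
  -- Since ξ is real, comparing heights gives τ·3^n = 1/6, and the terms in `c` cancel.
  have hξ' : ∀ c : ℂ, height c = 1 / 2 → c.re ^ 2 = 1 / 4 → (ξ : ℂ) = (1 / 2 : ℝ) -
      (1 / 6 : ℝ) * c + (τ * 3 ^ w.length : ℝ) * c → ξ = 1 / 2 := by
    intro c hc hc' he
    have h₁ := congrArg height he
    have h₂ := congrArg Complex.re he
    simp only [height_add, height_sub, height_ofReal, height_ofReal_mul, hc] at h₁
    simp only [Complex.add_re, Complex.sub_re, Complex.re_ofReal_mul, Complex.ofReal_re] at h₂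
    have h₃ : τ * 3 ^ w.length = 1 / 6 := by linarith
    rw [h₃] at h₂
    linarith
  suffices hh : ξ = 1 / 2 by rw [hx, hh, sideMid_eq]
  rcases hθ' with ⟨rfl, hθ'⟩ | ⟨rfl, hθ'⟩
  · refine hξ' zeta zeta_height (by rw [zeta_re]; norm_num) (chart_injective r w ?_)
    rw [e, sideMid_eq, chart_cons, childChart_one_half, hθ', chart_add, localDir_ofReal_mul,
      localDir_mul_unitDir]
    push_cast; ring_nf
  · refine hξ' (zeta ^ 2) zeta_sq_height (by rw [zeta_sq_re]; norm_num) (chart_injective r w ?_)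
    rw [e, sideMid_eq, chart_cons, childChart_two_half, hθ', chart_add, localDir_ofReal_mul,
      localDir_mul_unitDir]
    push_cast; ring_nf

/-- The initial conditions of a piecewise Fagnano sequence are midpoints of nested sides. -/
lemma IsCompatibleSeq.exists_addresses (h : IsCompatibleSeq x θ) {M : ℕ}
    (hM : ∀ n, M + 1 ≤ n → IsCellSideMidpoint n (x n)) :
    ∃ σ : ℂ, σ ^ 2 = 1 ∧ ∃ (r : Fin 3) (w : ℕ → List (Fin 4)),
      (∀ i, (w i).length = M + i) ∧ (∀ i, (x (M + i), θ) = phase σ r (w i)) ∧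
      ∀ i, w (i + 1) = lastHit σ r (w i) :: w i := by
  have key : ∀ i, ∃ (r : Fin 3) (w : List (Fin 4)) (d : Fin 4), w.length = M + i ∧
      x (M + i) = sideMid r w ∧ x (M + i + 1) = sideMid r (d :: w) ∧
      (d = 1 ∧ θ = zeta * unitDir r w ∨ d = 2 ∧ θ = zeta ^ 2 * unitDir r w) := fun i =>
    h.exists_child_of_midpoint_succ (hM _ (by omega)) (hM _ (by omega))
  choose r w d hw hx hx' hθ using key
  -- The invariant σ is the cube of the common direction.
  have hσ : (θ ^ 3) ^ 2 = 1 := by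
    have hz := zeta_pow_six
    have hu := unitDir_pow_six (r 0) (w 0)
    rcases hθ 0 with ⟨-, h⟩ | ⟨-, h⟩ <;> rw [h]
    · linear_combination hz * unitDir (r 0) (w 0) ^ 6 + hu
    · linear_combination hz * (zeta ^ 6 + 1) * unitDir (r 0) (w 0) ^ 6 + hu
  have hl : ∀ i, θ = launch (θ ^ 3) (r i) (w i) := fun i =>
    eq_launch hσ ((hθ i).imp And.right And.right) rfl
  have hd : ∀ i, d i = lastHit (θ ^ 3) (r i) (w i) := by
    intro i
    rcases hθ i with ⟨h₁, h₂⟩ | ⟨h₁, h₂⟩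
    · have : unitDir (r i) (w i) ^ 3 = -θ ^ 3 := by
        rw [h₂]; linear_combination unitDir (r i) (w i) ^ 3 * zeta_pow_three
      rw [h₁, lastHit, if_neg (this ▸ ne_neg_of_sq hσ)]
    · have : unitDir (r i) (w i) ^ 3 = θ ^ 3 := by
        rw [h₂]; linear_combination -(unitDir (r i) (w i) ^ 3) * zeta_pow_six
      rw [h₁, lastHit, if_pos this]
  have hs : ∀ i, r (i + 1) = r i ∧ w (i + 1) = d i :: w i := by
    intro i
    refine sideMid_injective ?_ ((hx (i + 1)).symm.trans (hx' i))
    simp [hw]; ring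
  have hr : ∀ i, r i = r 0 := fun i => by
    induction i with
    | zero => rfl
    | succ i ih => rw [(hs i).1, ih]
  refine ⟨θ ^ 3, hσ, r 0, w, hw, fun i => ?_, fun i => ?_⟩
  · rw [phase, ← hr i, ← hl i, hx]
  · rw [(hs i).2, hd, hr]

end CompatibleSeq

/-! ### The billiard map on addresses -/

/-- Addresses of sides. -/
abbrev Address := Fin 3 × List (Fin 4)

/-- The point of the phase space over the side with a given address. -/
def point (σ : ℂ) (a : Address) : ℂ × ℂ := phase σ a.1 a.2

/-- The address of the side that is hit after launching from a side. -/
def next (σ : ℂ) (a : Address) : Address :=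
  ((exists_flight (σ := σ) a.1 a.2).choose, (exists_flight (σ := σ) a.1 a.2).choose_spec.choose)

/-- The address of the side of the cell over a side which is hit last. -/
def lastSide (σ : ℂ) (a : Address) : Address := (a.1, lastHit σ a.1 a.2 :: a.2)

/-- The address of the side of the cell over a side which is hit first. -/
def firstSide (σ : ℂ) (a : Address) : Address := (a.1, firstHit σ a.1 a.2 :: a.2)

lemma flight_next (σ : ℂ) (a : Address) : ∃ τ, Flight σ a.1 a.2 (next σ a).1 (next σ a).2 τ :=
  (exists_flight (σ := σ) a.1 a.2).choose_spec.choose_spec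

lemma length_next (σ : ℂ) (a : Address) : (next σ a).2.length = a.2.length :=
  (flight_next σ a).choose_spec.length_eq

lemma length_iterate_next (σ : ℂ) (a : Address) (k : ℕ) :
    ((next σ)^[k] a).2.length = a.2.length := by
  induction k with
  | zero => rfl
  | succ k ih => rw [Function.iterate_succ_apply', length_next, ih]

lemma point_injective {σ : ℂ} {a b : Address} (h : a.2.length = b.2.length)
    (e : point σ a = point σ b) : a = b := by
  obtain ⟨h₁, h₂⟩ := sideMid_injective h (congrArg Prod.fst e)
  exact Prod.ext h₁ h₂

section

variable {σ : ℂ} (hσ : σ ^ 2 = 1)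
include hσ

lemma billiardMap_point (a : Address) :
    billiardMap a.2.length (point σ a) = point σ (next σ a) :=
  (flight_next σ a).choose_spec.billiardMap_eq hσ

lemma iterate_billiardMap_point {n : ℕ} (a : Address) (ha : a.2.length = n) (k : ℕ) :
    (billiardMap n)^[k] (point σ a) = point σ ((next σ)^[k] a) := by
  induction k with
  | zero => rfl
  | succ k ih =>
    rw [Function.iterate_succ_apply', Function.iterate_succ_apply', ih, ← billiardMap_point hσ,
      length_iterate_next, ha]

lemma next_eq_of_flight {a b : Address} {τ : ℝ} (h : Flight σ a.1 a.2 b.1 b.2 τ) : next σ a = b :=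
  point_injective (by rw [length_next, h.length_eq])
    ((billiardMap_point hσ a).symm.trans (h.billiardMap_eq hσ))

lemma next_firstSide (a : Address) : next σ (firstSide σ a) = lastSide σ a :=
  next_eq_of_flight hσ (flight_cell hσ a.1 a.2)

lemma next_lastSide (a : Address) : next σ (lastSide σ a) = firstSide σ (next σ a) := by
  obtain ⟨τ, h⟩ := flight_next σ a
  exact next_eq_of_flight hσ (h.lift hσ)

/-- Two collisions above correspond to one below: into the next cell, then across it. -/
lemma iterate_next_lastSide (a : Address) (k : ℕ) :
    (next σ)^[2 * k] (lastSide σ a) = lastSide σ ((next σ)^[k] a) := by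
  induction k with
  | zero => rfl
  | succ k ih =>
    rw [show 2 * (k + 1) = 2 * k + 1 + 1 by ring, Function.iterate_succ_apply',
      Function.iterate_succ_apply', ih, next_lastSide hσ, next_firstSide hσ,
      Function.iterate_succ_apply']

lemma iterate_next_lastSide_add_one (a : Address) (k : ℕ) :
    (next σ)^[2 * k + 1] (lastSide σ a) = firstSide σ ((next σ)^[k + 1] a) := by
  rw [Function.iterate_succ_apply', iterate_next_lastSide hσ, next_lastSide hσ,
    Function.iterate_succ_apply']

/-- Deleting the last character of the address corresponds to `pairIndex` on the indices. -/
lemma exists_child_iterate (a : Address) {k : ℕ} (hk : 1 ≤ k) :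
    ∃ d : Fin 4, (d = 1 ∨ d = 2) ∧ (next σ)^[k] (lastSide σ a) =
      (((next σ)^[pairIndex k] a).1, d :: ((next σ)^[pairIndex k] a).2) := by
  -- The cases β = 1 and β = 2: odd times land on the first-hit side, even times on the last-hit
  -- side, both over the iterate ζ + 1.
  obtain ⟨ζ, rfl | rfl⟩ : ∃ ζ, k = 2 * ζ + 1 ∨ k = 2 * (ζ + 1) := ⟨(k - 1) / 2, by omega⟩
  · rw [show pairIndex (2 * ζ + 1) = ζ + 1 by unfold pairIndex; omega,
      iterate_next_lastSide_add_one hσ]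
    refine ⟨_, ?_, rfl⟩
    have := lastHit_eq_or σ ((next σ)^[ζ + 1] a).1 ((next σ)^[ζ + 1] a).2
    tauto
  · rw [show pairIndex (2 * (ζ + 1)) = ζ + 1 by unfold pairIndex; omega,
      iterate_next_lastSide hσ]
    refine ⟨_, ?_, rfl⟩
    have := lastHit_eq_or σ ((next σ)^[ζ + 1] a).1 ((next σ)^[ζ + 1] a).2
    tauto

lemma exists_iterate_eq_child (a : Address) (k : ℕ) {d : Fin 4} (hd : d = 1 ∨ d = 2) :
    ∃ k', (next σ)^[k'] (lastSide σ a) =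
      (((next σ)^[k + 1] a).1, d :: ((next σ)^[k + 1] a).2) := by
  have h₁ := iterate_next_lastSide_add_one hσ a k
  have h₂ := iterate_next_lastSide hσ a (k + 1)
  rcases lastHit_eq_or σ ((next σ)^[k + 1] a).1 ((next σ)^[k + 1] a).2 with ⟨h, h'⟩ | ⟨h, h'⟩ <;>
    rw [firstSide, h'] at h₁ <;> rw [lastSide, lastSide, h] at h₂ <;> rcases hd with rfl | rfl
  exacts [⟨_, h₂⟩, ⟨_, h₁⟩, ⟨_, h₁⟩, ⟨_, h₂⟩]

end

/-! ### Orbits of nested initial conditions -/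

/-- Nested initial sides, starting at level `M`, whose orbits are periodic. -/
structure NestedOrbits (σ : ℂ) (M : ℕ) (a : ℕ → Address) : Prop where
  sq_eq_one : σ ^ 2 = 1
  length_eq : ∀ i, (a i).2.length = M + i
  succ_eq : ∀ i, a (i + 1) = lastSide σ (a i)
  periodic : ∀ i, ∃ k, 0 < k ∧ (billiardMap (M + i))^[k] (point σ (a i)) = point σ (a i)

namespace NestedOrbits

variable {σ : ℂ} {M : ℕ} {a : ℕ → Address} (H : NestedOrbits σ M a)
include H

/-- The addresses of the sides visited by the orbit at level `M + i`. -/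
def visited (_ : NestedOrbits σ M a) (i : ℕ) : Set Address := range fun k => (next σ)^[k] (a i)

lemma length_of_mem_visited {i : ℕ} {b : Address} (hb : b ∈ H.visited i) :
    b.2.length = M + i := by
  obtain ⟨k, rfl⟩ := hb
  exact (length_iterate_next σ _ k).trans (H.length_eq i)

lemma orbit_eq (i : ℕ) : orbit (M + i) (point σ (a i)) = point σ '' H.visited i := by
  ext p
  simp only [orbit, visited, iterate_billiardMap_point H.sq_eq_one _ (H.length_eq i), mem_image,
    mem_range, exists_exists_eq_and]
  exact exists_congr fun k => eq_comm

lemma exists_period (i : ℕ) : ∃ k, 0 < k ∧ (next σ)^[k] (a i) = a i := by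
  obtain ⟨k, hk, h⟩ := H.periodic i
  rw [iterate_billiardMap_point H.sq_eq_one _ (H.length_eq i)] at h
  exact ⟨k, hk, point_injective (length_iterate_next σ _ k) h⟩

/-- Going round once more gives a positive index, as `orbitIndex` counts from 1. -/
lemma exists_iterate_of_mem_visited {i : ℕ} {b : Address} (hb : b ∈ H.visited i) :
    ∃ k, (next σ)^[k + 1] (a i) = b := by
  obtain ⟨k, rfl⟩ := hb
  obtain ⟨p, hp, h⟩ := H.exists_period i
  refine ⟨k + (p - 1), ?_⟩
  rw [show k + (p - 1) + 1 = k + p by omega, Function.iterate_add_apply, h]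

lemma finite_visited (i : ℕ) : (H.visited i).Finite := by
  obtain ⟨p, hp, h⟩ := H.exists_period i
  refine ((finite_lt_nat p).image fun k => (next σ)^[k] (a i)).subset ?_
  rintro _ ⟨k, rfl⟩
  refine ⟨k % p, Nat.mod_lt _ hp, ?_⟩
  exact (Function.IsPeriodicPt.iterate_mod_apply (f := next σ) h k)

lemma ncard_orbit (i : ℕ) :
    (orbit (M + i) (point σ (a i))).ncard = (H.visited i).ncard := by
  rw [H.orbit_eq]
  refine InjOn.ncard_image fun b hb c hc h => point_injective ?_ h
  rw [H.length_of_mem_visited hb, H.length_of_mem_visited hc]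

/-- Each visited side has exactly two visited children, whatever the orbit: the binary branching
behind the Cantor set. -/
lemma mem_visited_succ {i : ℕ} {b : Address} :
    b ∈ H.visited (i + 1) ↔ ∃ c ∈ H.visited i, ∃ d : Fin 4, (d = 1 ∨ d = 2) ∧ b = (c.1, d :: c.2) := by
  constructor
  · intro hb
    obtain ⟨k, rfl⟩ := H.exists_iterate_of_mem_visited hb
    obtain ⟨d, hd, h⟩ := exists_child_iterate H.sq_eq_one (a i) (k := k + 1) (by omega)
    exact ⟨_, mem_range_self _, d, hd, by rw [H.succ_eq, h]⟩
  · rintro ⟨c, hc, d, hd, rfl⟩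
    obtain ⟨k, rfl⟩ := H.exists_iterate_of_mem_visited hc
    obtain ⟨k', h⟩ := exists_iterate_eq_child H.sq_eq_one (a i) k hd
    exact ⟨k', by rw [H.succ_eq]; exact h⟩

lemma iterate_pairIndex (i l : ℕ) {k : ℕ} (hk : 1 ≤ k) :
    (next σ)^[pairIndex^[l] k] (a i) =
      (((next σ)^[k] (a (i + l))).1, ((next σ)^[k] (a (i + l))).2.drop l) := by
  induction l generalizing k with
  | zero => rfl
  | succ l ih =>
    obtain ⟨d, -, h⟩ := exists_child_iterate H.sq_eq_one (a (i + l)) hk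
    rw [← add_assoc, H.succ_eq, h, Function.iterate_succ_apply,
      ih (show 1 ≤ pairIndex k from Nat.le_add_left 1 _)]
    rfl

lemma drop_initial (i l : ℕ) : ((a (i + l)).1, (a (i + l)).2.drop l) = a i := by
  induction l with
  | zero => rfl
  | succ l ih => rw [← add_assoc, H.succ_eq]; exact ih

omit H in
lemma truncate_sideMid (m : ℕ) (b : Address) :
    truncate m b.2.length (sideMid b.1 b.2) = sideMid b.1 (b.2.drop (b.2.length - m)) := by
  have h : ∃ c : Fin 3 × List (Fin 4), c.2.length = b.2.length ∧
      sideMid b.1 b.2 = sideMid c.1 c.2 := ⟨b, rfl, rfl⟩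
  rw [truncate, dif_pos h]
  obtain ⟨h₁, h₂⟩ := h.choose_spec
  obtain ⟨h₃, h₄⟩ := sideMid_injective h₁.symm h₂
  rw [← h₃, ← h₄]

/-- The transition maps delete the last characters of addresses. -/
lemma transition_point (i l : ℕ) {b : Address} (hb : b ∈ H.visited (i + l)) :
    transition (M + i) (M + (i + l)) (point σ (a (i + l))) (point σ b) =
      point σ (b.1, b.2.drop l) := by
  have hne : {k | 1 ≤ k ∧ (billiardMap (M + (i + l)))^[k] (point σ (a (i + l))) = point σ b}.Nonempty := by
    obtain ⟨k, rfl⟩ := H.exists_iterate_of_mem_visited hb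
    exact ⟨k + 1, Nat.le_add_left 1 k,
      iterate_billiardMap_point H.sq_eq_one _ (H.length_eq _) _⟩
  obtain ⟨hk, h⟩ := Nat.sInf_mem hne
  rw [transition, orbitIndex]
  set k := sInf {k | 1 ≤ k ∧ (billiardMap (M + (i + l)))^[k] (point σ (a (i + l))) = point σ b}
  rw [iterate_billiardMap_point H.sq_eq_one _ (H.length_eq _)] at h
  have hb' : (next σ)^[k] (a (i + l)) = b := by
    refine point_injective ?_ h
    rw [length_iterate_next, H.length_eq, H.length_of_mem_visited hb]
  have h₁ : (truncate (M + i) (M + (i + l)) (point σ (a (i + l))).1, (point σ (a (i + l))).2) =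
      point σ (a i) := by
    have h₂ := truncate_sideMid (M + i) (a (i + l))
    rw [H.length_eq, show M + (i + l) - (M + i) = l by omega] at h₂
    have h₃ := H.drop_initial i l
    refine Prod.ext (h₂.trans ?_) ?_
    · rw [← h₃]; rfl
    · have h₄ : ∀ l, launch σ (a (i + l)).1 (a (i + l)).2 = launch σ (a i).1 (a i).2 := by
        intro l
        induction l with
        | zero => rfl
        | succ l ih =>
          rw [← ih, ← add_assoc, H.succ_eq]
          exact launch_child H.sq_eq_one _ _
      exact h₄ l
  rw [h₁, iterate_billiardMap_point H.sq_eq_one _ (H.length_eq _),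
    show M + (i + l) - (M + i) = l by omega, H.iterate_pairIndex i l hk, hb']

end NestedOrbits

/-! ### Coding of the footprint -/

/-- The characters of the two sides of a cell. -/
def letter : Fin 2 → Fin 4 := ![1, 2]

lemma letter_injective : Function.Injective letter := by decide

lemma exists_letter {d : Fin 4} (hd : d = 1 ∨ d = 2) : ∃ j, d = letter j := by
  rcases hd with rfl | rfl
  exacts [⟨0, rfl⟩, ⟨1, rfl⟩]

lemma letter_eq_or (j : Fin 2) : letter j = 1 ∨ letter j = 2 := by
  fin_cases j <;> simp [letter]

/-- The first `i` characters of a sequence, as the end of an address. -/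
def codeWord (ω : ℕ → Fin 2) : ℕ → List (Fin 4)
  | 0 => []
  | i + 1 => letter (ω i) :: codeWord ω i

/-- The sequence of phase points coded by a side and a sequence. -/
def codePoint (σ : ℂ) (b : Address) (ω : ℕ → Fin 2) (i : ℕ) : ℂ × ℂ :=
  point σ (b.1, codeWord ω (i + 1) ++ b.2)

namespace NestedOrbits

variable {σ : ℂ} {M : ℕ} {a : ℕ → Address} (H : NestedOrbits σ M a)
include H

lemma codeWord_mem_visited {b : Address} (hb : b ∈ H.visited 0) (ω : ℕ → Fin 2) (i : ℕ) :
    (b.1, codeWord ω i ++ b.2) ∈ H.visited i := by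
  induction i with
  | zero => exact hb
  | succ i ih => exact H.mem_visited_succ.2 ⟨_, ih, _, letter_eq_or (ω i), rfl⟩

omit H in
lemma drop_codeWord_append (ω : ℕ → Fin 2) (i l : ℕ) (v : List (Fin 4)) :
    (codeWord ω (i + l) ++ v).drop l = codeWord ω i ++ v := by
  induction l with
  | zero => rfl
  | succ l ih => exact ih

/-- The points of the inverse limit are coded by a side visited at level `M` and a sequence. -/
lemma mem_inverseLimit_iff {p : ℕ → ℂ × ℂ} :
    ((∀ i, p i ∈ orbit (M + (i + 1)) (point σ (a (i + 1)))) ∧ ∀ i j, i ≤ j →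
      transition (M + (i + 1)) (M + (j + 1)) (point σ (a (j + 1))) (p j) = p i) ↔
    ∃ b ∈ H.visited 0, ∃ ω, p = codePoint σ b ω := by
  constructor
  · rintro ⟨h₁, h₂⟩
    simp only [H.orbit_eq] at h₁
    choose c hc hp using h₁
    have hdrop : ∀ i, ((c (i + 1)).1, (c (i + 1)).2.drop 1) = c i := by
      intro i
      have h := h₂ i (i + 1) (Nat.le_succ i)
      rw [← hp i, ← hp (i + 1)] at h
      have h' := H.transition_point (i + 1) 1 (hc (i + 1))
      refine point_injective ?_ (h'.symm.trans h)
      have := H.length_of_mem_visited (hc (i + 1))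
      have := H.length_of_mem_visited (hc i)
      simp; omega
    have hletter : ∀ i, ∃ j, ∃ e ∈ H.visited i, c i = (e.1, letter j :: e.2) := by
      intro i
      obtain ⟨e, he, d, hd, h⟩ := H.mem_visited_succ.1 (hc i)
      obtain ⟨j, rfl⟩ := exists_letter hd
      exact ⟨j, e, he, h⟩
    choose ω e he hω using hletter
    -- Coordinate 0 lives at level M + 1; removing its last letter gives the base side `e 0` of
    -- level M.
    refine ⟨e 0, he 0, ω, funext fun i => ?_⟩
    rw [← hp i, codePoint]
    congr 1
    induction i with
    | zero => exact hω 0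
    | succ i ih =>
      have h := hdrop i
      rw [hω (i + 1)] at h ⊢
      have h' : e (i + 1) = c i := h
      rw [h', ih]; rfl
  · rintro ⟨b, hb, ω, rfl⟩
    refine ⟨fun i => ?_, fun i j hij => ?_⟩
    · rw [H.orbit_eq]
      exact mem_image_of_mem _ (H.codeWord_mem_visited hb ω (i + 1))
    · obtain ⟨l, rfl⟩ := Nat.exists_eq_add_of_le hij
      have h := H.transition_point (i + 1) l (b := (b.1, codeWord ω (i + 1 + l) ++ b.2))
        (H.codeWord_mem_visited hb ω (i + 1 + l))
      rw [drop_codeWord_append, add_right_comm] at h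
      exact h

end NestedOrbits

/-! ### The self-similar Cantor set over the unit interval -/

/-- The composition of the first `i` maps of the iterated function system chosen by `ω`. -/
def codeMap (ω : ℕ → Fin 2) : ℕ → ℂ → ℂ
  | 0 => id
  | i + 1 => codeMap ω i ∘ childChart (letter (ω i))

lemma chart_codeWord (r : Fin 3) (w : List (Fin 4)) (ω : ℕ → Fin 2) (i : ℕ) (z : ℂ) :
    chart r (codeWord ω i ++ w) z = chart r w (codeMap ω i z) := by
  induction i generalizing z with
  | zero => rfl
  | succ i ih => rw [codeWord, List.cons_append, chart_cons, ih]; rfl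

/-- The definition appends maps on the inside; self-similarity of the limit needs the outermost map
peeled off. -/
lemma codeMap_succ (ω : ℕ → Fin 2) (i : ℕ) (z : ℂ) :
    codeMap ω (i + 1) z = childChart (letter (ω 0)) (codeMap (fun k => ω (k + 1)) i z) := by
  induction i generalizing z with
  | zero => rfl
  | succ i ih => rw [codeMap, Function.comp_apply, ih]; rfl

lemma dist_childChart (d : Fin 4) (y z : ℂ) :
    dist (childChart d y) (childChart d z) = 1 / 3 * dist y z := by
  have h₁ := dist_chart 0 (d :: []) y z
  rw [chart_cons, chart_cons, dist_chart] at h₁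
  simpa using h₁

lemma dist_codeMap (ω : ℕ → Fin 2) (i : ℕ) (y z : ℂ) :
    dist (codeMap ω i y) (codeMap ω i z) = (1 / 3) ^ i * dist y z := by
  induction i generalizing y z with
  | zero => simp [codeMap]
  | succ i ih =>
    rw [codeMap, Function.comp_apply, Function.comp_apply, ih, dist_childChart]; ring

lemma codeMap_mem_hull (ω : ℕ → Fin 2) (i : ℕ) {z : ℂ} (hz : z ∈ hull) : codeMap ω i z ∈ hull := by
  induction i generalizing z with
  | zero => exact hz
  | succ i ih => exact ih (childChart_mem_hull _ hz)

lemma dist_half_childChart (j : Fin 2) :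
    dist ((1 / 2 : ℝ) : ℂ) (childChart (letter j) (1 / 2 : ℝ)) ≤ 1 := by
  rw [dist_eq_norm]
  rcases letter_eq_or j with h | h <;> rw [h]
  · rw [childChart_one_half, sub_sub_cancel, norm_mul, norm_zeta]; norm_num
  · rw [childChart_two_half, sub_sub_cancel, norm_mul, norm_pow, norm_zeta]; norm_num

lemma dist_codeMap_succ_le (ω : ℕ → Fin 2) (i : ℕ) :
    dist (codeMap ω i (1 / 2 : ℝ)) (codeMap ω (i + 1) (1 / 2 : ℝ)) ≤ 1 * (1 / 3) ^ i := by
  rw [codeMap, Function.comp_apply, dist_codeMap, mul_comm]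
  gcongr
  exact dist_half_childChart _

/-- The point of the Cantor set over the unit interval coded by `ω`. -/
def codeLimit (ω : ℕ → Fin 2) : ℂ := limUnder atTop fun i => codeMap ω i (1 / 2 : ℝ)

lemma tendsto_codeMap (ω : ℕ → Fin 2) :
    Tendsto (fun i => codeMap ω i (1 / 2 : ℝ)) atTop (𝓝 (codeLimit ω)) :=
  (cauchySeq_of_le_geometric (1 / 3) 1 (by norm_num) (dist_codeMap_succ_le ω)).tendsto_limUnder

lemma dist_codeLimit_le (ω : ℕ → Fin 2) (i : ℕ) :
    dist (codeMap ω i (1 / 2 : ℝ)) (codeLimit ω) ≤ 1 * (1 / 3) ^ i / (1 - 1 / 3) :=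
  dist_le_of_le_geometric_of_tendsto (1 / 3) 1 (by norm_num) (dist_codeMap_succ_le ω)
    (tendsto_codeMap ω) i

lemma codeLimit_eq (ω : ℕ → Fin 2) :
    codeLimit ω = childChart (letter (ω 0)) (codeLimit fun k => ω (k + 1)) := by
  have h₁ := (tendsto_add_atTop_iff_nat 1).2 (tendsto_codeMap ω)
  simp only [codeMap_succ] at h₁
  have hc : Continuous (childChart (letter (ω 0))) := by
    unfold childChart segChart; fun_prop
  exact tendsto_nhds_unique h₁ ((hc.tendsto _).comp (tendsto_codeMap _))

lemma isClosed_closedHull : IsClosed closedHull := by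
  unfold closedHull
  refine IsClosed.and (isClosed_le ?_ ?_) (IsClosed.and (isClosed_le ?_ ?_)
      (isClosed_le ?_ ?_)) <;> fun_prop

/-- A limit of hull points is only known to lie in `closedHull`, but child maps 1 and 2 carry that
into `hull`, away from 0 and 1. -/
lemma codeLimit_mem_hull (ω : ℕ → Fin 2) : codeLimit ω ∈ hull := by
  rw [codeLimit_eq]
  have h : codeLimit (fun k => ω (k + 1)) ∈ closedHull :=
    isClosed_closedHull.mem_of_tendsto (tendsto_codeMap _)
      (Eventually.of_forall fun i => hull_subset_closedHull (codeMap_mem_hull _ i half_mem_hull))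
  generalize codeLimit (fun k => ω (k + 1)) = z at h
  obtain ⟨h₁, h₂, h₃⟩ := h
  have hr := childChart_re (letter (ω 0)) z
  have hh := childChart_height (letter (ω 0)) z
  rcases letter_eq_or (ω 0) with h | h <;> rw [h] at hr hh ⊢ <;> simp at hr hh <;>
    refine ⟨?_, ?_, ?_, ?_, ?_⟩ <;> simp only [hr, hh] <;> linarith

lemma childChart_injective (d : Fin 4) : Function.Injective (childChart d) := fun y z h => by
  have := dist_childChart d y z
  rw [h, dist_self] at this
  exact dist_eq_zero.1 (by linarith)

/-- Disjoint child hulls reveal the first letter; shifting the sequences reveals the others. -/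
lemma codeLimit_injective : Function.Injective codeLimit := by
  intro ω ω' h
  have key : ∀ (i : ℕ) (ω ω' : ℕ → Fin 2), codeLimit ω = codeLimit ω' → ω i = ω' i := by
    intro i
    induction i with
    | zero =>
      intro ω ω' h
      rw [codeLimit_eq ω, codeLimit_eq ω'] at h
      exact letter_injective (childChart_hull_disjoint (codeLimit_mem_hull _) (codeLimit_mem_hull _) h)
    | succ i ih =>
      intro ω ω' h
      have h₀ : letter (ω 0) = letter (ω' 0) := by
        rw [codeLimit_eq ω, codeLimit_eq ω'] at h
        exact childChart_hull_disjoint (codeLimit_mem_hull _) (codeLimit_mem_hull _) h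
      rw [codeLimit_eq ω, codeLimit_eq ω', h₀] at h
      exact ih (fun k => ω (k + 1)) (fun k => ω' (k + 1)) (childChart_injective _ h)
  exact funext fun i => key i ω ω' h

/-! ### Limits of coded sequences -/

/-- The point of the snowflake coded by a side and a sequence. -/
def limitPoint (b : Address) (ω : ℕ → Fin 2) : ℂ := chart b.1 b.2 (codeLimit ω)

lemma codePoint_fst (σ : ℂ) (b : Address) (ω : ℕ → Fin 2) (i : ℕ) :
    (codePoint σ b ω i).1 = chart b.1 b.2 (codeMap ω (i + 1) (1 / 2 : ℝ)) := by
  rw [← chart_codeWord, ← sideMid_eq]; rfl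

lemma tendsto_codePoint (σ : ℂ) (b : Address) (ω : ℕ → Fin 2) :
    Tendsto (fun i => (codePoint σ b ω i).1) atTop (𝓝 (limitPoint b ω)) := by
  simp only [codePoint_fst]
  exact ((continuous_chart b.1 b.2).tendsto _).comp
    ((tendsto_add_atTop_iff_nat 1).2 (tendsto_codeMap ω))

/-- Uniformity in `b` and `ω` makes `baseLimit` a uniform limit of coordinate maps, hence continuous
on the footprint. -/
lemma dist_codePoint_le (σ : ℂ) (b : Address) (ω : ℕ → Fin 2) (i : ℕ) :
    dist (limitPoint b ω) (codePoint σ b ω i).1 ≤ 2 * (1 / 3) ^ i := by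
  rw [codePoint_fst, limitPoint, dist_chart, dist_comm]
  have h₁ := dist_codeLimit_le ω (i + 1)
  have h₂ : ((1 : ℝ) / 3) ^ b.2.length ≤ 1 := pow_le_one₀ (by norm_num) (by norm_num)
  calc _ ≤ 1 * dist (codeMap ω (i + 1) (1 / 2 : ℝ)) (codeLimit ω) := by gcongr
    _ ≤ 1 * (1 * (1 / 3) ^ (i + 1) / (1 - 1 / 3)) := by gcongr
    _ = 1 / 2 * (1 / 3) ^ i := by rw [pow_succ]; ring
    _ ≤ 2 * (1 / 3) ^ i := by gcongr; norm_num

lemma limitPoint_injective {b b' : Address} (hb : b.2.length = b'.2.length) {ω ω' : ℕ → Fin 2}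
    (h : limitPoint b ω = limitPoint b' ω') : b = b' ∧ ω = ω' := by
  obtain ⟨h₁, h₂⟩ := address_eq_of_hull hb (codeLimit_mem_hull ω) (codeLimit_mem_hull ω') h
  obtain rfl : b = b' := Prod.ext h₁ h₂
  exact ⟨rfl, codeLimit_injective (chart_injective _ _ h)⟩

/-- Contraction makes the starting point irrelevant, so the images of the end point 0, which are
vertices, have the same limit as the midpoints. -/
lemma limitPoint_mem_snowflake (b : Address) (ω : ℕ → Fin 2) : limitPoint b ω ∈ snowflake := by
  have h₁ : Tendsto (fun i => chart b.1 b.2 (codeMap ω i (0 : ℂ))) atTop (𝓝 (limitPoint b ω)) := by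
    refine ((continuous_chart b.1 b.2).tendsto _).comp ?_
    refine (tendsto_codeMap ω).congr_dist ?_
    simp only [dist_codeMap]
    have := tendsto_pow_atTop_nhds_zero_of_lt_one (r := (1 / 3 : ℝ)) (by norm_num) (by norm_num)
    simpa using this.mul_const (dist ((1 / 2 : ℝ) : ℂ) 0)
  refine mem_closure_of_tendsto h₁ (Eventually.of_forall fun i => ?_)
  refine ⟨_, b.1, codeWord ω i ++ b.2, rfl, ?_⟩
  rw [← chart_codeWord]
  simp [chart, segChart]

lemma isLocallyConstant_codeWord (i : ℕ) : IsLocallyConstant fun ω => codeWord ω i := by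
  induction i with
  | zero => exact IsLocallyConstant.const []
  | succ i ih =>
    have h : IsLocallyConstant fun ω : ℕ → Fin 2 => ω i :=
      (IsLocallyConstant.iff_continuous _).2 (continuous_apply i)
    exact h.comp₂ ih fun j l => letter j :: l

lemma continuous_codePoint (σ : ℂ) (b : Address) : Continuous (codePoint σ b) := by
  refine continuous_pi fun i => IsLocallyConstant.continuous ?_
  exact (isLocallyConstant_codeWord (i + 1)).comp fun l => point σ (b.1, l ++ b.2)

/-- The Cantor set over a side. -/
def cantorOver (b : Address) : Set ℂ := range (limitPoint b)

/-- The two similarities generating the Cantor set over a side. -/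
def generator (b : Address) (j : Fin 2) (z : ℂ) : ℂ :=
  chart b.1 b.2 (childChart (letter j) (coord b.1 b.2 z))

lemma dist_coord (r : Fin 3) (w : List (Fin 4)) (y z : ℂ) :
    (1 / 3) ^ w.length * dist (coord r w y) (coord r w z) = dist y z := by
  rw [← dist_chart, chart_coord, chart_coord]

lemma isContractingSimilarity_generator (b : Address) (j : Fin 2) :
    IsContractingSimilarity (generator b j) := by
  refine ⟨1 / 3, by norm_num, by norm_num, fun y z => ?_⟩
  rw [generator, generator, dist_chart, dist_childChart, ← dist_coord b.1 b.2 y z]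
  ring

lemma generator_limitPoint (b : Address) (j : Fin 2) (ω : ℕ → Fin 2) :
    generator b j (limitPoint b ω) = limitPoint b (fun k => Nat.casesOn k j ω) := by
  rw [generator, limitPoint, coord_chart, limitPoint, codeLimit_eq (fun k => Nat.casesOn k j ω)]
  rfl

lemma isAttractor_cantorOver {b : Address} (hc : IsCompact (cantorOver b)) :
    IsAttractor (generator b) (cantorOver b) := by
  refine ⟨range_nonempty _, hc, Subset.antisymm ?_ ?_⟩
  · refine iUnion_subset fun j => ?_
    rintro _ ⟨_, ⟨ω, rfl⟩, rfl⟩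
    exact ⟨_, (generator_limitPoint b j ω).symm⟩
  · rintro _ ⟨ω, rfl⟩
    refine mem_iUnion.2 ⟨ω 0, _, ⟨fun k => ω (k + 1), rfl⟩, ?_⟩
    rw [generator_limitPoint]
    congr 1
    funext k
    cases k <;> rfl

/-- Charts of one level have equal ratio, so the change of chart is an isometry. -/
lemma exists_isometryEquiv {b b' : Address} (h : b.2.length = b'.2.length) :
    ∃ g : ℂ ≃ᵢ ℂ, g '' cantorOver b = cantorOver b' := by
  refine ⟨IsometryEquiv.mk ⟨fun z => chart b'.1 b'.2 (coord b.1 b.2 z),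
    fun z => chart b.1 b.2 (coord b'.1 b'.2 z), fun z => by simp, fun z => by simp⟩ ?_, ?_⟩
  · refine Isometry.of_dist_eq fun y z => ?_
    change dist (chart _ _ _) (chart _ _ _) = _
    rw [dist_chart, ← h, dist_coord]
  · rw [cantorOver, cantorOver, ← range_comp]
    congr 1
    funext ω
    change chart _ _ (coord _ _ (limitPoint b ω)) = _
    rw [limitPoint, coord_chart]; rfl

/-! ### The footprint -/

/-- The set of all coded sequences over a finite set of sides of the same level. -/
def codeSet (σ : ℂ) (B : Set Address) : Set (ℕ → ℂ × ℂ) := {p | ∃ b ∈ B, ∃ ω, p = codePoint σ b ω}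

/-- The limit of the base points. -/
def baseLimit (p : ℕ → ℂ × ℂ) : ℂ := limUnder atTop fun i => (p i).1

lemma baseLimit_codePoint (σ : ℂ) (b : Address) (ω : ℕ → Fin 2) :
    baseLimit (codePoint σ b ω) = limitPoint b ω := (tendsto_codePoint σ b ω).limUnder_eq

section CodeSet

variable {σ : ℂ} {B : Set Address}

lemma continuousOn_baseLimit : ContinuousOn baseLimit (codeSet σ B) := by
  have h : TendstoUniformlyOn (fun (i : ℕ) (p : ℕ → ℂ × ℂ) => (p i).1) baseLimit atTop
      (codeSet σ B) := by
    rw [Metric.tendstoUniformlyOn_iff]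
    intro ε hε
    have h₁ := (tendsto_pow_atTop_nhds_zero_of_lt_one (r := (1 / 3 : ℝ)) (by norm_num)
      (by norm_num)).const_mul 2
    rw [mul_zero] at h₁
    filter_upwards [h₁.eventually_lt_const hε] with i hi
    rintro p ⟨b, -, ω, rfl⟩
    rw [baseLimit_codePoint]
    exact (dist_codePoint_le σ b ω i).trans_lt hi
  exact h.continuousOn (Frequently.of_forall fun i => by fun_prop)

lemma baseLimit_image : baseLimit '' codeSet σ B = ⋃ b ∈ B, cantorOver b := by
  ext z
  simp only [codeSet, mem_image, mem_iUnion, cantorOver, mem_range, exists_prop]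
  constructor
  · rintro ⟨_, ⟨b, hb, ω, rfl⟩, rfl⟩
    exact ⟨b, hb, ω, (baseLimit_codePoint σ b ω).symm⟩
  · rintro ⟨b, hb, ω, rfl⟩
    exact ⟨_, ⟨b, hb, ω, rfl⟩, baseLimit_codePoint σ b ω⟩

lemma isCompact_codeSet (hB : B.Finite) : IsCompact (codeSet σ B) := by
  have h := hB.isCompact_biUnion fun b _ => isCompact_range (continuous_codePoint σ b)
  convert h using 1
  ext p
  simp [codeSet, eq_comm]

lemma isCompact_cantorOver (b : Address) : IsCompact (cantorOver b) := by
  -- The base points, and so the limits, do not depend on σ; any value serves.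
  have h := (isCompact_codeSet (σ := 1) (finite_singleton b)).image_of_continuousOn
    continuousOn_baseLimit
  rwa [baseLimit_image, biUnion_singleton] at h

lemma injOn_baseLimit {M : ℕ} (hM : ∀ b ∈ B, b.2.length = M) : InjOn baseLimit (codeSet σ B) := by
  rintro _ ⟨b, hb, ω, rfl⟩ _ ⟨b', hb', ω', rfl⟩ h
  rw [baseLimit_codePoint, baseLimit_codePoint] at h
  obtain ⟨rfl, rfl⟩ := limitPoint_injective ((hM b hb).trans (hM b' hb').symm) h
  rfl

lemma isEmbedding_baseLimit (hB : B.Finite) {M : ℕ} (hM : ∀ b ∈ B, b.2.length = M) :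
    IsEmbedding ((codeSet σ B).domRestrict baseLimit) := by
  have : CompactSpace (codeSet σ B) := isCompact_iff_compactSpace.1 (isCompact_codeSet hB)
  exact (Continuous.isClosedEmbedding (continuousOn_iff_continuous_domRestrict.1 continuousOn_baseLimit)
    (injOn_iff_injective.1 (injOn_baseLimit hM))).isEmbedding

/-- Each coordinate takes countably many values, so it is constant on connected subsets. -/
lemma isTotallyDisconnected_codeSet (hB : B.Finite) : IsTotallyDisconnected (codeSet σ B) := by
  intro t ht hc p hp q hq
  funext i
  have hfin : {z | ∃ p ∈ codeSet σ B, z = p i}.Countable := by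
    have h : (⋃ b ∈ B, range fun l => point σ (b.1, l ++ b.2)).Countable :=
      hB.countable.biUnion fun b _ => countable_range _
    refine h.mono ?_
    rintro _ ⟨_, ⟨b, hb, ω, rfl⟩, rfl⟩
    exact mem_biUnion hb ⟨codeWord ω (i + 1), rfl⟩
  refine hfin.isTotallyDisconnected ((fun p => p i) '' t) ?_
    (hc.image _ (continuous_apply i).continuousOn) (mem_image_of_mem _ hp) (mem_image_of_mem _ hq)
  rintro _ ⟨p, hp, rfl⟩
  exact ⟨p, ht hp, rfl⟩

lemma perfect_codeSet (hB : B.Finite) :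
    Perfect (codeSet σ B) := by
  refine ⟨(isCompact_codeSet hB).isClosed, ?_⟩
  rintro _ ⟨b, hb, ω, rfl⟩
  rw [accPt_iff_frequently]
  -- Flipping the kth letter alone gives codes different from `ω` that converge to it.
  set ω' : ℕ → ℕ → Fin 2 := fun k => Function.update ω k (1 - ω k) with hω'
  have ht : Tendsto ω' atTop (𝓝 ω) := by
    refine tendsto_pi_nhds.2 fun i => tendsto_const_nhds.congr' ?_
    filter_upwards [eventually_gt_atTop i] with k hk
    simp [hω', Function.update_of_ne hk.ne]
  have ht' : Tendsto (fun k => codePoint σ b (ω' k)) atTop (𝓝 (codePoint σ b ω)) :=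
    ((continuous_codePoint σ b).tendsto ω).comp ht
  refine ht'.frequently (Frequently.of_forall fun k => ⟨fun h => ?_, b, hb, _, rfl⟩)
  have h₁ := congrArg baseLimit h
  rw [baseLimit_codePoint, baseLimit_codePoint] at h₁
  have h₂ := congrFun (limitPoint_injective rfl h₁).2 k
  simp only [hω', Function.update_self] at h₂
  revert h₂
  generalize ω k = j
  revert j
  decide

lemma isSelfSimilarUnion_baseLimit (hB : B.Finite) {M : ℕ} (hM : ∀ b ∈ B, b.2.length = M) :
    IsSelfSimilarUnion B.ncard (baseLimit '' codeSet σ B) := by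
  have := hB.to_subtype
  let e : B ≃ Fin B.ncard := Finite.equivFinOfCardEq (Nat.card_coe_set_eq B)
  refine ⟨fun i => generator (e.symm i), fun i => cantorOver (e.symm i),
    fun i j => isContractingSimilarity_generator _ j,
    fun i => isAttractor_cantorOver (isCompact_cantorOver _), fun i i' => ?_, fun i i' hi => ?_, ?_⟩
  · exact exists_isometryEquiv ((hM _ (e.symm i).2).trans (hM _ (e.symm i').2).symm)
  · rw [disjoint_left]
    rintro _ ⟨ω, rfl⟩ ⟨ω', h⟩
    have h' := (limitPoint_injective ((hM _ (e.symm i').2).trans (hM _ (e.symm i).2).symm) h).1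
    exact hi (e.symm.injective (Subtype.ext h'.symm))
  · rw [baseLimit_image, biUnion_eq_iUnion]
    exact (e.symm.surjective.iUnion_comp fun b : B => cantorOver b).symm

end CodeSet

lemma IsPiecewiseFagnanoSeq.exists_nestedOrbits {x : ℕ → ℂ} {θ : ℂ}
    (h : IsPiecewiseFagnanoSeq x θ) : ∃ (σ : ℂ) (M : ℕ) (a : ℕ → Address), startLevel x = M + 1 ∧
      NestedOrbits σ M a ∧ ∀ i, (x (M + i), θ) = point σ (a i) := by
  have hN : ∀ n, startLevel x ≤ n → IsCellSideMidpoint n (x n) := Nat.sInf_mem h.fagnano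
  -- There are no cells at level 0, so a level M = N - 1 exists; its orbit supplies the Ξ pieces.
  have hpos : startLevel x ≠ 0 := by
    intro h0
    obtain ⟨r, w, d, hw, -⟩ := hN 0 h0.le
    omega
  obtain ⟨M, hM⟩ := Nat.exists_eq_succ_of_ne_zero hpos
  rw [hM] at hN
  obtain ⟨σ, hσ, r, w, hw, hx, hs⟩ := h.compatible.exists_addresses hN
  refine ⟨σ, M, fun i => (r, w i), hM, ⟨hσ, hw, fun i => ?_, fun i => ?_⟩, hx⟩
  · change (r, w (i + 1)) = _
    rw [hs]; rfl
  · obtain ⟨k, hk, e⟩ := (h.periodic (M + i)).1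
    rw [hx] at e
    exact ⟨k, hk, e⟩

end KochBilliard

end

theorem mainTheorem6 (x : ℕ → ℂ) (θ : ℂ) (h : KochBilliard.IsPiecewiseFagnanoSeq x θ) :
    KochBilliard.IsTopologicalCantorSet (KochBilliard.footprint x θ) ∧
    ∃ L : (ℕ → ℂ × ℂ) → ℂ,
      (∀ p ∈ KochBilliard.footprint x θ,
        Filter.Tendsto (fun i => (p i).1) Filter.atTop (nhds (L p))) ∧
      Topology.IsEmbedding ((KochBilliard.footprint x θ).domRestrict L) ∧
      L '' KochBilliard.footprint x θ ⊆ KochBilliard.snowflake ∧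
      KochBilliard.IsSelfSimilarUnion
        (KochBilliard.orbit (KochBilliard.startLevel x - 1)
          (x (KochBilliard.startLevel x - 1), θ)).ncard
        (L '' KochBilliard.footprint x θ) := by

  obtain ⟨σ, M, a, hM, H, hx⟩ := h.exists_nestedOrbits
  have hF : KochBilliard.footprint x θ = KochBilliard.codeSet σ (H.visited 0) := by
    ext p
    rw [KochBilliard.codeSet, Set.mem_ofPred_eq, ← H.mem_inverseLimit_iff]
    simp only [KochBilliard.footprint, Set.mem_ofPred_eq, hM, ← hx, add_assoc, add_comm 1]
  have hfin := H.finite_visited 0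
  have hlen : ∀ b ∈ H.visited 0, b.2.length = M := fun b hb => H.length_of_mem_visited hb
  have hcard : (KochBilliard.orbit (KochBilliard.startLevel x - 1)
      (x (KochBilliard.startLevel x - 1), θ)).ncard = (H.visited 0).ncard := by
    have h₀ := H.ncard_orbit 0
    rw [← hx] at h₀
    rw [hM]
    exact h₀
  rw [hcard, hF]
  refine ⟨⟨⟨_, _, ⟨0, rfl⟩, fun _ => 0, rfl⟩, KochBilliard.isCompact_codeSet hfin,
    KochBilliard.isTotallyDisconnected_codeSet hfin, KochBilliard.perfect_codeSet hfin⟩,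
    KochBilliard.baseLimit, ?_, KochBilliard.isEmbedding_baseLimit hfin hlen, ?_,
    KochBilliard.isSelfSimilarUnion_baseLimit hfin hlen⟩
  · rintro _ ⟨b, -, ω, rfl⟩
    rw [KochBilliard.baseLimit_codePoint]
    exact KochBilliard.tendsto_codePoint σ b ω
  · rintro _ ⟨_, ⟨b, -, ω, rfl⟩, rfl⟩
    rw [KochBilliard.baseLimit_codePoint]
    exact KochBilliard.limitPoint_mem_snowflake b ω
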